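/- **Setting.** Let $G=(V,E)$ be a connected, non-bipartite graph with $n\ge 2$ nodes, and let $(p_e)_{e\in E}$ satisfy $p_e>0$ and $\sum_{e\in E}p_e=1$. Node $k$ holds a real observation $X_k$, and the $X_k$ are pairwise distinct. Let $0<\alpha<1/2$, $m=\lfloor\alpha n\rfloor$, $a=m+\tfrac12$, $b=n-m+\tfrac12$, $r_k=1+\#\{l: X_l<X_k\}$, let $\bar x_\alpha=\frac1{n-2m}\sum_{k:\,m+1\le r_k\le n-m}X_k$ be the trimmed mean, and let $w(r)=\mathbb I\{a\le r\le b\}/(1-2m/n)$. **Synchronous GoTrim.** Put $Y_k(0)=X_k$, $R'_k(0)=0$, $W_k(0)=0$, $N_k(0)=0$. At each iteration $t=1,2,\dots$, every node $k$ sets $$R'_k(t)=\bigl(1-\tfrac1t\bigr)R'_k(t-1)+\tfrac1t\,\mathbb I\{X_k>Y_k(t-1)\},\qquad R_k(t)=nR'_k(t)+1,\qquad W_k(t)=w(R_k(t)).$$ Then an edge $\{i,j\}$ is drawn with law $p$, independently of the past, and $$\mathbf N(t)=\mathbf W_2(t)\bigl(\mathbf N(t-1)+(\mathbf W(t)-\mathbf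 W(t-1))\odot \mathbf X\bigr),\qquad \mathbf W_2(t)=\mathbf I_n-\tfrac12(\mathbf e_i-\mathbf e_j)(\mathbf e_i-\mathbf e_j)^\top ,$$ while $Y(t)$ is obtained from $Y(t-1)$ by swapping the entries $i$ and $j$. **Constants.** Let $c$ be the second smallest eigenvalue of $\sum_{\{i,j\}\in E}p_{\{i,j\}}(\mathbf e_i-\mathbf e_j)(\mathbf e_i-\mathbf e_j)^\top$, let $\lambda_2(2)$ be the second largest eigenvalue of $\mathbb E[\mathbf W_2(t)]$, and let $\tilde c=1-\sqrt{\lambda_2(2)}$. Let $\sigma_n(r)=n^{3/2}\sqrt{u(1-u)}$ with $u=(r-1)/n$, $\gamma_k=\min(|r_k-a|,|r_k-b|)$, and $K_k=\dfrac{\sqrt6\,\sigma_n(r_k)}{\gamma_k(1-2\alpha)}$. **Theorem.** There is a universal constant $C>0$ such that, in every such setting, there is $T^*>0$ with $$\mathbb E\bigl\|\mathbf N(t)-\bar x_\alpha\mathbf 1_n\bigr\|_2\;\le\;\frac{C}{\tilde c\,\sqrt{c\,t}}\;\|\mathbf K\odot\mathbf X\|_2\qquad\text{for every integer } t>T^*.$$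 Here $T^*$ is bounded by a quantity that depends only on $\tilde c$ if $\lfloor\alpha n\rfloor\ge1$, and only on $\tilde c$ and $\mathbf X$ in general. -/

import Mathlib

open MeasureTheory ProbabilityTheory

namespace GoTrim

variable {V : Type*} [Fintype V] [DecidableEq V]

noncomputable section

/-! ### The data: ranks, trimmed mean, weights -/

/-- The number `m = ⌊α n⌋` of observations trimmed on each side. -/
def trimCount (V : Type*) [Fintype V] (α : ℝ) : ℕ := ⌊α * (Fintype.card V : ℝ)⌋₊

/-- The rank `r_k = 1 + #{l : X_l < X_k}`. -/
def rank (X : V → ℝ) (k : V) : ℕ := 1 + (Finset.univ.filter fun l => X l < X k).card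

/-- The `α`-trimmed mean: average of the `n - 2m` observations with rank in `[m + 1, n - m]`. -/
def trimmedMean (α : ℝ) (X : V → ℝ) : ℝ :=
  (∑ k ∈ Finset.univ.filter (fun k => trimCount V α + 1 ≤ rank X k ∧
      rank X k + trimCount V α ≤ Fintype.card V), X k) /
    ((Fintype.card V : ℝ) - 2 * (trimCount V α : ℝ))

/-- Left endpoint `a = m + 1/2` of the inclusion interval. -/
def leftEnd (V : Type*) [Fintype V] (α : ℝ) : ℝ := (trimCount V α : ℝ) + 1 / 2

/-- Right endpoint `b = n - m + 1/2` of the inclusion interval. -/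
def rightEnd (V : Type*) [Fintype V] (α : ℝ) : ℝ :=
  (Fintype.card V : ℝ) - (trimCount V α : ℝ) + 1 / 2

open Classical in
/-- The weight function `w(r) = 1{a ≤ r ≤ b} / (1 - 2 m / n)`. -/
def weightFun (V : Type*) [Fintype V] (α : ℝ) (r : ℝ) : ℝ :=
  if leftEnd V α ≤ r ∧ r ≤ rightEnd V α then
    1 / (1 - 2 * (trimCount V α : ℝ) / (Fintype.card V : ℝ))
  else 0

/-- `γ_k = min (|r_k - a|) (|r_k - b|)`. -/
def gap (α : ℝ) (X : V → ℝ) (k : V) : ℝ :=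
  min |(rank X k : ℝ) - leftEnd V α| |(rank X k : ℝ) - rightEnd V α|

/-- `φ(u) = √(u (1 - u))`. -/
def score (u : ℝ) : ℝ := √(u * (1 - u))

/-- `σ_n(r) = n ^ (3/2) φ((r - 1) / n)`. -/
def rankSigma (n : ℕ) (r : ℝ) : ℝ := (n : ℝ) ^ (3 / 2 : ℝ) * score ((r - 1) / (n : ℝ))

/-- `K_k = √6 σ_n(r_k) / (γ_k (1 - 2α))`. -/
def coeffK (α : ℝ) (X : V → ℝ) (k : V) : ℝ :=
  √6 * rankSigma (Fintype.card V) (rank X k : ℝ) / (gap α X k * (1 - 2 * α))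

/-! ### Edge sampling and spectral quantities -/

/-- `p` is a probability distribution on the edges of `G` charging every edge. -/
structure IsEdgeDistribution (G : SimpleGraph V) (p : Sym2 V → ℝ) : Prop where
  pos : ∀ e ∈ G.edgeSet, 0 < p e
  zero : ∀ e ∉ G.edgeSet, p e = 0
  sum_one : ∑ e, p e = 1

/-- `ξ 1, ξ 2, …` are independent random edges with common distribution `p`;
`ξ t` is the edge drawn at iteration `t`. -/
structure IsEdgeSampling {Ω : Type*} [MeasurableSpace Ω] (μ : Measure Ω) (p : Sym2 V → ℝ)
    (ξ : ℕ → Ω → Sym2 V) : Prop where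
  measurable : ∀ t, Measurable[_, ⊤] (ξ t)
  law : ∀ t e, μ.real (ξ t ⁻¹' {e}) = p e
  indep : iIndepFun (m := fun _ => (⊤ : MeasurableSpace (Sym2 V))) ξ μ

/-- The elementary Laplacian `L_e = (e_i - e_j) (e_i - e_j)ᵀ` of `e = {i, j}`. -/
def edgeLaplacian : Sym2 V → Matrix V V ℝ :=
  Sym2.lift ⟨fun i j => Matrix.vecMulVec (Pi.single i 1 - Pi.single j 1 : V → ℝ)
      (Pi.single i 1 - Pi.single j 1 : V → ℝ), fun i j => by
    beta_reduce
    rw [← neg_sub (Pi.single j 1 : V → ℝ) (Pi.single i 1), Matrix.neg_vecMulVec,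
      Matrix.vecMulVec_neg, neg_neg]⟩

/-- The averaging matrix `W_2 = I - L_e / 2` of an edge. -/
def averagingMatrix (e : Sym2 V) : Matrix V V ℝ := 1 - (1 / 2 : ℝ) • edgeLaplacian e

/-- The Laplacian `L(P) = ∑_e p_e L_e` of the weighted graph. -/
def laplacian (p : Sym2 V → ℝ) : Matrix V V ℝ := ∑ e, p e • edgeLaplacian e

/-- The expectation `∑_e p_e W_2(e)` of the averaging matrix of a random edge. -/
def meanAveragingMatrix (p : Sym2 V → ℝ) : Matrix V V ℝ := ∑ e, p e • averagingMatrix e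

theorem edgeLaplacian_isHermitian {V : Type*} [DecidableEq V] (e : Sym2 V) : (edgeLaplacian e).IsHermitian := by
  induction e using Sym2.ind with
  | _ i j =>
    ext a b
    simp [edgeLaplacian, Matrix.vecMulVec_apply, mul_comm]

theorem averagingMatrix_isHermitian {V : Type*} [DecidableEq V] (e : Sym2 V) : (averagingMatrix e).IsHermitian :=
  Matrix.isHermitian_one.sub ((edgeLaplacian_isHermitian e).smul (IsSelfAdjoint.all _))

theorem laplacian_isHermitian (p : Sym2 V → ℝ) : (laplacian p).IsHermitian :=
  isSelfAdjoint_sum _ fun e _ => (edgeLaplacian_isHermitian e).smul (IsSelfAdjoint.all _)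

theorem meanAveragingMatrix_isHermitian (p : Sym2 V → ℝ) : (meanAveragingMatrix p).IsHermitian :=
  isSelfAdjoint_sum _ fun e _ => (averagingMatrix_isHermitian e).smul (IsSelfAdjoint.all _)

/-- The spectral gap `c`: second smallest eigenvalue (with multiplicity) of `L(P)`.
The family `eigenvalues₀` is in decreasing order and indexed from `0`. -/
def spectralGap [Nontrivial V] (p : Sym2 V → ℝ) : ℝ :=
  (laplacian_isHermitian p).eigenvalues₀
    ⟨Fintype.card V - 2, Nat.sub_lt Fintype.card_pos two_pos⟩

/-- `λ₂(2)`: second largest eigenvalue (with multiplicity) of the mean averaging matrix. -/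
def lambdaTwo [Nontrivial V] (p : Sym2 V → ℝ) : ℝ :=
  (meanAveragingMatrix_isHermitian p).eigenvalues₀ ⟨1, Fintype.one_lt_card⟩

/-- `c̃ = 1 - √λ₂(2)`. -/
def cTilde [Nontrivial V] (p : Sym2 V → ℝ) : ℝ := 1 - √(lambdaTwo p)

/-! ### The synchronous algorithm along a sequence of edges `e 1, e 2, …`

At iteration `t ≥ 1` every node updates its rank estimate by comparing its observation with the
auxiliary observation it holds, updates its weight, and injects the change of weight times its
observation into its estimate; then the edge `e t` is drawn, its two nodes average their estimates
and swap their auxiliary observations. -/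

/-- Exchange of the two endpoints of an edge. -/
def swapEdge : Sym2 V → Equiv.Perm V :=
  Sym2.lift ⟨fun i j => Equiv.swap i j, fun i j => Equiv.swap_comm i j⟩

/-- The auxiliary observations `Y(t)` after `t` iterations. -/
def auxObs (X : V → ℝ) (e : ℕ → Sym2 V) : ℕ → V → ℝ
  | 0 => X
  | t + 1 => fun k => auxObs X e t (swapEdge (e (t + 1)) k)

open Classical in
/-- The normalized rank estimates `R'(t)`: running averages of the comparisons. -/
def normRankEst (X : V → ℝ) (e : ℕ → Sym2 V) : ℕ → V → ℝ
  | 0 => fun _ => 0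
  | t + 1 => fun k => (1 - 1 / ((t + 1 : ℕ) : ℝ)) * normRankEst X e t k +
      1 / ((t + 1 : ℕ) : ℝ) * (if auxObs X e t k < X k then 1 else 0)

/-- The rank estimates `R(t) = n R'(t) + 1`. -/
def rankEst (X : V → ℝ) (e : ℕ → Sym2 V) (t : ℕ) (k : V) : ℝ :=
  (Fintype.card V : ℝ) * normRankEst X e t k + 1

/-- The weights `W(t)`: initially zero, then `w(R(t))`. -/
def weight (α : ℝ) (X : V → ℝ) (e : ℕ → Sym2 V) : ℕ → V → ℝ
  | 0 => fun _ => 0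
  | t + 1 => fun k => weightFun V α (rankEst X e (t + 1) k)

/-- The estimates `N(t) = W_2(e t) (N(t - 1) + (W(t) - W(t - 1)) ⊙ X)`, with `N(0) = 0`. -/
def estimate (α : ℝ) (X : V → ℝ) (e : ℕ → Sym2 V) : ℕ → V → ℝ
  | 0 => fun _ => 0
  | t + 1 => (averagingMatrix (e (t + 1))).mulVec
      (estimate α X e t + (weight α X e (t + 1) - weight α X e t) * X)

/-- The Euclidean norm of a real vector indexed by `V`. -/
def l2norm (v : V → ℝ) : ℝ := ‖(WithLp.toLp 2 v : EuclideanSpace ℝ V)‖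

end

end GoTrim

/-!
The error of the rank estimate of node `k` at time `t` is `n / t` times a sum of `t` centred
comparisons. Conditionally on the past, the expected comparisons evolve under the mean exchange
operator `I - L(P)`, whose orbits on mean-zero vectors have partial sums `O(1 / c)`; summing the
lagged covariances bounds the mean square error by `4 σ_n(r_k)² / (c t)`. A weight can be wrong only
if the rank estimate misses by at least `γ_k`, so the mean square of `(W(t) - w(r)) ⊙ X` is at
most `‖K ⊙ X‖² / (c t)`.

The estimates have the same mean as `W(t) ⊙ X`, and the root mean square of their deviation from it
contracts by `1 - c̃` at each iteration, up to injections `(W(t) - W(t - 1)) ⊙ X` of size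
`O(1 / √(c t))`; such a recursion loses a factor `1 / c̃`. The only other contribution is the first
injection `w(1) X`. It vanishes when `m ≥ 1` and otherwise decays geometrically, eventually below
the `1 / √t` bound, since `K ⊙ X ≠ 0` when `n ≥ 3`.
-/

namespace GoTrim

open WithLp (toLp)
open scoped Matrix

variable {V : Type*}

/-! ### Euclidean norm -/

section Norm

variable [Fintype V] (x y : V → ℝ)

theorem l2norm_sq : l2norm x ^ 2 = ∑ k, x k ^ 2 := by
  simp [l2norm, EuclideanSpace.norm_sq_eq]

theorem dotProduct_self_eq_l2norm_sq : x ⬝ᵥ x = l2norm x ^ 2 := by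
  rw [l2norm_sq]
  simp only [dotProduct, sq]

theorem l2norm_nonneg : 0 ≤ l2norm x := norm_nonneg _

theorem dotProduct_le_l2norm_mul_l2norm : x ⬝ᵥ y ≤ l2norm x * l2norm y := by
  have h := real_inner_le_norm (toLp 2 y : EuclideanSpace ℝ V) (toLp 2 x)
  rwa [EuclideanSpace.inner_toLp_toLp, star_trivial, mul_comm] at h

theorem abs_apply_le_l2norm (k : V) : |x k| ≤ l2norm x :=
  PiLp.norm_apply_le (toLp 2 x : EuclideanSpace ℝ V) k

theorem l2norm_sub_le : l2norm (x - y) ≤ l2norm x + l2norm y :=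
  norm_sub_le (toLp 2 x : EuclideanSpace ℝ V) (toLp 2 y)

theorem l2norm_smul (a : ℝ) : l2norm (a • x) = |a| * l2norm x := by
  rw [l2norm, WithLp.toLp_smul, norm_smul, Real.norm_eq_abs, l2norm]

theorem l2norm_comp_perm (f : Equiv.Perm V) : l2norm (x ∘ f) = l2norm x :=
  (LinearIsometryEquiv.piLpCongrLeft 2 ℝ ℝ f.symm).norm_map (toLp 2 x)

theorem l2norm_sum_smul_le {ι : Type*} (s : Finset ι) {c : ι → ℝ} (hc : ∀ i, 0 ≤ c i)
    (f : ι → V → ℝ) : l2norm (∑ i ∈ s, c i • f i) ≤ ∑ i ∈ s, c i * l2norm (f i) := by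
  have h := norm_sum_le s fun i => c i • (toLp 2 (f i) : EuclideanSpace ℝ V)
  simpa only [l2norm, norm_smul, Real.norm_of_nonneg (hc _), WithLp.toLp_sum, WithLp.toLp_smul]
    using h

end Norm

/-! ### Edge operators -/

section Edge

variable [DecidableEq V]

theorem edgeLaplacian_mk (i j : V) : edgeLaplacian s(i, j) =
    Matrix.vecMulVec (Pi.single i 1 - Pi.single j 1 : V → ℝ) (Pi.single i 1 - Pi.single j 1) :=
  rfl

variable [Fintype V]

theorem edgeLaplacian_mk_mulVec (i j : V) (x : V → ℝ) :
    edgeLaplacian s(i, j) *ᵥ x =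
      (x i - x j) • (Pi.single i 1 - Pi.single j 1 : V → ℝ) := by
  rw [edgeLaplacian_mk, Matrix.vecMulVec_mulVec]
  simp only [sub_dotProduct, single_dotProduct, one_mul, op_smul_eq_smul]

theorem dotProduct_edgeLaplacian_mk_mulVec_self (i j : V) (x : V → ℝ) :
    x ⬝ᵥ edgeLaplacian s(i, j) *ᵥ x = (x i - x j) ^ 2 := by
  simp [edgeLaplacian_mk_mulVec, dotProduct_sub, sq]

theorem dotProduct_edgeLaplacian_mulVec_self_nonneg (e : Sym2 V) (x : V → ℝ) :
    0 ≤ x ⬝ᵥ edgeLaplacian e *ᵥ x := by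
  induction e with
  | _ i j => rw [dotProduct_edgeLaplacian_mk_mulVec_self]; exact sq_nonneg _

theorem edgeLaplacian_mul_self (e : Sym2 V) :
    edgeLaplacian e * edgeLaplacian e = (2 : ℝ) • edgeLaplacian e := by
  induction e with
  | _ i j =>
    rcases eq_or_ne i j with rfl | hij
    · simp [edgeLaplacian_mk]
    · have hdot : (Pi.single i 1 - Pi.single j 1 : V → ℝ) ⬝ᵥ
          (Pi.single i 1 - Pi.single j 1) = 2 := by
        simp [dotProduct_sub, hij, hij.symm, one_add_one_eq_two]
      simp only [edgeLaplacian_mk, Matrix.vecMulVec_mul_vecMulVec, hdot, Matrix.vecMulVec_smul]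

theorem averagingMatrix_mul_self (e : Sym2 V) :
    averagingMatrix e * averagingMatrix e = averagingMatrix e := by
  simp only [averagingMatrix, mul_sub, sub_mul, mul_one, one_mul, smul_mul_assoc, mul_smul_comm,
    edgeLaplacian_mul_self]
  module

theorem l2norm_sq_averagingMatrix_mulVec (e : Sym2 V) (x : V → ℝ) :
    l2norm (averagingMatrix e *ᵥ x) ^ 2 = x ⬝ᵥ averagingMatrix e *ᵥ x := by
  have hsymm : (averagingMatrix e).transpose = averagingMatrix e := averagingMatrix_isHermitian e
  rw [← dotProduct_self_eq_l2norm_sq, Matrix.dotProduct_mulVec, ← Matrix.mulVec_transpose, hsymm,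
    Matrix.mulVec_mulVec, averagingMatrix_mul_self, dotProduct_comm]

theorem averagingMatrix_mulVec (e : Sym2 V) (x : V → ℝ) :
    averagingMatrix e *ᵥ x = x - (1 / 2 : ℝ) • edgeLaplacian e *ᵥ x := by
  simp [averagingMatrix, Matrix.sub_mulVec, Matrix.smul_mulVec]

theorem sum_edgeLaplacian_mulVec (e : Sym2 V) (x : V → ℝ) :
    ∑ k, (edgeLaplacian e *ᵥ x) k = 0 := by
  induction e with
  | _ i j => simp [edgeLaplacian_mk_mulVec, ← Finset.mul_sum]

theorem sum_averagingMatrix_mulVec (e : Sym2 V) (x : V → ℝ) :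
    ∑ k, (averagingMatrix e *ᵥ x) k = ∑ k, x k := by
  simp [averagingMatrix_mulVec, ← Finset.mul_sum, sum_edgeLaplacian_mulVec]

theorem edgeLaplacian_mulVec_const (e : Sym2 V) (a : ℝ) :
    edgeLaplacian e *ᵥ (fun _ => a) = 0 := by
  induction e with
  | _ i j => simp [edgeLaplacian_mk_mulVec]

theorem averagingMatrix_mulVec_const (e : Sym2 V) (a : ℝ) :
    averagingMatrix e *ᵥ (fun _ => a) = fun _ => a := by
  simp [averagingMatrix_mulVec, edgeLaplacian_mulVec_const]

theorem comp_swapEdge (e : Sym2 V) (x : V → ℝ) :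
    x ∘ swapEdge e = x - edgeLaplacian e *ᵥ x := by
  induction e with
  | _ i j =>
    ext k
    have hswap : swapEdge s(i, j) = Equiv.swap i j := rfl
    rw [edgeLaplacian_mk_mulVec, hswap]
    rcases eq_or_ne k i with rfl | hi
    · rcases eq_or_ne k j with rfl | hj <;> simp [*]
    · rcases eq_or_ne k j with rfl | hj
      · simp [hi]
      · simp [hi, hj, Equiv.swap_apply_of_ne_of_ne hi hj]

theorem edgeLaplacian_mulVec_of_card_eq_two (hV : Fintype.card V = 2) {e : Sym2 V}
    (he : ¬ e.IsDiag) {x : V → ℝ} (hx : ∑ k, x k = 0) :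
    edgeLaplacian e *ᵥ x = (2 : ℝ) • x := by
  induction e with
  | _ i j =>
    have hij : i ≠ j := he
    have huniv : (Finset.univ : Finset V) = {i, j} :=
      (Finset.eq_univ_of_card _ ((Finset.card_pair hij).trans hV.symm)).symm
    rw [huniv, Finset.sum_pair hij, add_eq_zero_iff_eq_neg'] at hx
    ext k
    have hk : k = i ∨ k = j := by simpa [huniv] using Finset.mem_univ k
    rw [edgeLaplacian_mk_mulVec]
    rcases hk with rfl | rfl
    · simp [hij, hx, two_mul]
    · simp [hij.symm, hx, two_mul]

end Edge

section Distribution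

variable [Fintype V] {G : SimpleGraph V} {p : Sym2 V → ℝ}

theorem IsEdgeDistribution.nonneg (hp : IsEdgeDistribution G p) (e : Sym2 V) : 0 ≤ p e := by
  by_cases he : e ∈ G.edgeSet
  · exact (hp.pos e he).le
  · exact (hp.zero e he).ge

variable [DecidableEq V]

theorem laplacian_mulVec (p : Sym2 V → ℝ) (x : V → ℝ) :
    laplacian p *ᵥ x = ∑ e, p e • edgeLaplacian e *ᵥ x := by
  simp [laplacian, Matrix.sum_mulVec, Matrix.smul_mulVec]

theorem sum_laplacian_mulVec (p : Sym2 V → ℝ) (x : V → ℝ) :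
    ∑ k, (laplacian p *ᵥ x) k = 0 := by
  simp only [laplacian_mulVec, Finset.sum_apply, Pi.smul_apply, smul_eq_mul]
  rw [Finset.sum_comm]
  simp [← Finset.mul_sum, sum_edgeLaplacian_mulVec]

theorem laplacian_mulVec_const (p : Sym2 V → ℝ) (a : ℝ) :
    laplacian p *ᵥ (fun _ => a) = 0 := by
  simp [laplacian_mulVec, edgeLaplacian_mulVec_const]

theorem dotProduct_laplacian_mulVec (p : Sym2 V → ℝ) (x : V → ℝ) :
    x ⬝ᵥ laplacian p *ᵥ x = ∑ e, p e * (x ⬝ᵥ edgeLaplacian e *ᵥ x) := by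
  simp [laplacian_mulVec, dotProduct_sum, dotProduct_smul]

theorem dotProduct_meanAveragingMatrix_mulVec (p : Sym2 V → ℝ) (x : V → ℝ) :
    x ⬝ᵥ meanAveragingMatrix p *ᵥ x =
      ∑ e, p e * l2norm (averagingMatrix e *ᵥ x) ^ 2 := by
  simp [meanAveragingMatrix, Matrix.sum_mulVec, Matrix.smul_mulVec, dotProduct_sum,
    dotProduct_smul, l2norm_sq_averagingMatrix_mulVec]

namespace IsEdgeDistribution

theorem meanAveragingMatrix_eq (hp : IsEdgeDistribution G p) :
    meanAveragingMatrix p = 1 - (1 / 2 : ℝ) • laplacian p := by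
  simp only [meanAveragingMatrix, averagingMatrix, laplacian, smul_sub, Finset.sum_sub_distrib,
    ← Finset.sum_smul, hp.sum_one, one_smul, Finset.smul_sum, smul_comm (1 / 2 : ℝ)]

theorem sum_smul_comp_swapEdge (hp : IsEdgeDistribution G p) (x : V → ℝ) :
    ∑ e, p e • (x ∘ swapEdge e) = x - laplacian p *ᵥ x := by
  simp only [comp_swapEdge, smul_sub, Finset.sum_sub_distrib, ← Finset.sum_smul, hp.sum_one,
    one_smul, laplacian_mulVec]

theorem l2norm_sub_laplacian_mulVec_le (hp : IsEdgeDistribution G p) (x : V → ℝ) :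
    l2norm (x - laplacian p *ᵥ x) ≤ l2norm x := by
  rw [← hp.sum_smul_comp_swapEdge]
  refine (l2norm_sum_smul_le _ hp.nonneg _).trans_eq ?_
  simp only [l2norm_comp_perm, ← Finset.sum_mul, hp.sum_one, one_mul]

theorem dotProduct_laplacian_mulVec_le (hp : IsEdgeDistribution G p) (x : V → ℝ) :
    x ⬝ᵥ laplacian p *ᵥ x ≤ 2 * l2norm x ^ 2 := by
  have h : 0 ≤ x ⬝ᵥ meanAveragingMatrix p *ᵥ x := by
    rw [dotProduct_meanAveragingMatrix_mulVec]
    exact Finset.sum_nonneg fun e _ => mul_nonneg (hp.nonneg e) (sq_nonneg _)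
  rw [hp.meanAveragingMatrix_eq, Matrix.sub_mulVec, Matrix.one_mulVec, Matrix.smul_mulVec,
    dotProduct_sub, dotProduct_smul, dotProduct_self_eq_l2norm_sq, smul_eq_mul] at h
  linarith

theorem eq_of_dotProduct_laplacian_mulVec_nonpos (hp : IsEdgeDistribution G p)
    (hG : G.Preconnected) {x : V → ℝ} (hx : x ⬝ᵥ laplacian p *ᵥ x ≤ 0) (i j : V) :
    x i = x j := by
  have hnonneg : ∀ e, 0 ≤ p e * (x ⬝ᵥ edgeLaplacian e *ᵥ x) := fun e =>
    mul_nonneg (hp.nonneg e) (dotProduct_edgeLaplacian_mulVec_self_nonneg e x)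
  have hadj : ∀ a b, G.Adj a b → x a = x b := by
    intro a b hab
    have hle : p s(a, b) * (x ⬝ᵥ edgeLaplacian s(a, b) *ᵥ x) ≤ 0 :=
      (Finset.single_le_sum (fun e _ => hnonneg e) (Finset.mem_univ s(a, b))).trans
        ((dotProduct_laplacian_mulVec p x).symm.trans_le hx)
    rw [dotProduct_edgeLaplacian_mk_mulVec_self] at hle
    have hsq := nonpos_of_mul_nonpos_right hle (hp.pos s(a, b) hab)
    exact sub_eq_zero.1 (pow_eq_zero_iff two_ne_zero |>.1 (le_antisymm hsq (sq_nonneg _)))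
  obtain ⟨w⟩ := hG i j
  induction w with
  | nil => rfl
  | cons h _ ih => exact (hadj _ _ h).trans ih

theorem laplacian_mulVec_of_card_eq_two (hp : IsEdgeDistribution G p) (hV : Fintype.card V = 2)
    {x : V → ℝ} (hx : ∑ k, x k = 0) : laplacian p *ᵥ x = (2 : ℝ) • x := by
  have hterm : ∀ e, p e • edgeLaplacian e *ᵥ x = p e • (2 : ℝ) • x := by
    intro e
    by_cases he : e ∈ G.edgeSet
    · rw [edgeLaplacian_mulVec_of_card_eq_two hV (G.not_isDiag_of_mem_edgeSet he) hx]
    · rw [hp.zero e he, zero_smul, zero_smul]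
  simp only [laplacian_mulVec, hterm, ← Finset.sum_smul, hp.sum_one, one_smul]

end IsEdgeDistribution

end Distribution

/-! ### Spectral estimates -/

section InnerProductSpace

open scoped InnerProductSpace

variable {E ι : Type*} [NormedAddCommGroup E] [InnerProductSpace ℝ E] [Fintype ι]
  (b : OrthonormalBasis ι ℝ E) {T : E →ₗ[ℝ] E} {l : ι → ℝ}

theorem inner_orthonormalBasis_map (hb : ∀ i, T (b i) = l i • b i) (i : ι) (y : E) :
    ⟪b i, T y⟫_ℝ = l i * ⟪b i, y⟫_ℝ := by
  classical
  conv_lhs => rw [← b.sum_repr' y]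
  simp [map_sum, hb, inner_sum, inner_smul_right, b.inner_eq_ite, mul_comm]

theorem mul_norm_sq_le_inner_map (hb : ∀ i, T (b i) = l i • b i) {i₀ : ι} {κ θ : ℝ}
    (hl : ∀ i ≠ i₀, κ ≤ l i) (hθ : θ < κ) {u : E} (hu₀ : u ≠ 0) (hu : T u = θ • u) {x : E}
    (hx : ⟪u, x⟫_ℝ = 0) : κ * ‖x‖ ^ 2 ≤ ⟪x, T x⟫_ℝ := by
  have horth : ∀ i ≠ i₀, ⟪b i, u⟫_ℝ = 0 := by
    intro i hi
    have h := inner_orthonormalBasis_map b hb i u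
    rw [hu, inner_smul_right, mul_eq_mul_right_iff] at h
    exact h.resolve_left (hθ.trans_le (hl i hi)).ne
  have hparallel : ∀ y, ⟪u, y⟫_ℝ = ⟪u, b i₀⟫_ℝ * ⟪b i₀, y⟫_ℝ := by
    intro y
    rw [← b.sum_inner_mul_inner u y]
    refine Fintype.sum_eq_single i₀ fun i hi => ?_
    rw [real_inner_comm, horth i hi, zero_mul]
  have hx₀ : ⟪b i₀, x⟫_ℝ = 0 := by
    rw [hparallel] at hx
    refine (mul_eq_zero.1 hx).resolve_left fun h => hu₀ ?_
    rw [← inner_self_eq_zero (𝕜 := ℝ), hparallel, h, zero_mul]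
  rw [← real_inner_self_eq_norm_sq, ← b.sum_inner_mul_inner, ← b.sum_inner_mul_inner x (T x),
    Finset.mul_sum]
  refine Finset.sum_le_sum fun i _ => ?_
  rw [inner_orthonormalBasis_map b hb, real_inner_comm]
  rcases eq_or_ne i i₀ with rfl | hi
  · simp [hx₀]
  · nlinarith [hl i hi, mul_self_nonneg ⟪b i, x⟫_ℝ]

end InnerProductSpace

section Matrix

variable [Fintype V]

theorem not_const_of_orthonormal {ι : Type*} {b : ι → EuclideanSpace ℝ V} (hb : Orthonormal ℝ b)
    {i j : ι} (hij : i ≠ j) (hi : ∀ k l, b i k = b i l) : ¬ ∀ k l, b j k = b j l := by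
  intro hj
  have : Nonempty V := not_isEmpty_iff.1 fun _ => hb.ne_zero i (Subsingleton.elim _ _)
  let k₀ : V := Classical.arbitrary V
  have hne : ∀ m, (∀ k l, b m k = b m l) → b m k₀ ≠ 0 := fun m hm h₀ =>
    hb.ne_zero m (by ext k; rw [hm k k₀, h₀]; rfl)
  have horth : (Fintype.card V : ℝ) * (b j k₀ * b i k₀) = 0 := by
    simpa [PiLp.inner_apply, fun k => hi k k₀, fun k => hj k k₀] using hb.2 hij
  have hcard : (Fintype.card V : ℝ) ≠ 0 := Nat.cast_ne_zero.2 Fintype.card_ne_zero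
  exact mul_ne_zero hcard (mul_ne_zero (hne j hj) (hne i hi)) horth

variable [DecidableEq V] {A : Matrix V V ℝ}

/-- The index in `V` of the `i`-th largest eigenvalue of a symmetric matrix: the eigenvector basis
of Mathlib is indexed by `V`, through an arbitrary numbering, and the ordered eigenvalues by
`Fin (card V)`. -/
noncomputable def eigenIndex (V : Type*) [Fintype V] : Fin (Fintype.card V) ≃ V :=
  Fintype.equivOfCardEq (Fintype.card_fin _)

theorem eigenvalues_eigenIndex (hA : A.IsHermitian) (i : Fin (Fintype.card V)) :
    hA.eigenvalues (eigenIndex V i) = hA.eigenvalues₀ i := by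
  simp [Matrix.IsHermitian.eigenvalues, eigenIndex]

theorem mulVec_eigenvectorBasis_eigenIndex (hA : A.IsHermitian) (i : Fin (Fintype.card V)) :
    A *ᵥ (hA.eigenvectorBasis (eigenIndex V i)).ofLp =
      hA.eigenvalues₀ i • (hA.eigenvectorBasis (eigenIndex V i)).ofLp := by
  rw [hA.mulVec_eigenvectorBasis, eigenvalues_eigenIndex]

theorem eigenvalues₀_eq_of_basis (hA : A.IsHermitian) {l : Fin (Fintype.card V) → ℝ}
    (hl : Antitone l) (b : Module.Basis (Fin (Fintype.card V)) ℝ (V → ℝ))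
    (hb : ∀ i, A *ᵥ b i = l i • b i) : hA.eigenvalues₀ = l := by
  have hdiag : LinearMap.toMatrix b b (Matrix.toLin' A) = Matrix.diagonal l := by
    ext i j
    rw [LinearMap.toMatrix_apply, Matrix.toLin'_apply, hb, map_smul, b.repr_self]
    rcases eq_or_ne i j with rfl | hij
    · simp
    · simp [hij]
  have hchar : A.charpoly = (Matrix.diagonal l).charpoly := by
    rw [← hdiag, LinearMap.charpoly_toMatrix, ← LinearMap.charpoly_toMatrix _ (Pi.basisFun ℝ V)]
    simp
  rw [← List.ofFn_inj, ← hA.sort_roots_charpoly_eq_eigenvalues₀, hchar,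
    Matrix.charpoly_diagonal, Polynomial.roots_prod _ _ (Finset.prod_ne_zero_iff.2 fun i _ =>
      Polynomial.X_sub_C_ne_zero (l i))]
  simp only [Polynomial.roots_X_sub_C, Multiset.bind_singleton, Fin.univ_val_map, Multiset.map_coe,
    List.map_ofFn, Function.comp_def, RCLike.re_to_real, Multiset.coe_sort]
  exact List.mergeSort_of_pairwise
    (by simpa only [decide_eq_true_eq, ← List.sortedGE_iff_pairwise] using hl.sortedGE_ofFn)

end Matrix

section Gap

variable [Fintype V] [DecidableEq V] {G : SimpleGraph V} {p : Sym2 V → ℝ}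

theorem IsEdgeDistribution.eigenvalues₀_meanAveragingMatrix (hp : IsEdgeDistribution G p)
    (i : Fin (Fintype.card V)) : (meanAveragingMatrix_isHermitian p).eigenvalues₀ i =
      1 - (laplacian_isHermitian p).eigenvalues₀ i.rev / 2 := by
  have hA := laplacian_isHermitian p
  let b := (hA.eigenvectorBasis.toBasis.reindex (Fin.revPerm.trans (eigenIndex V)).symm).map
    (WithLp.linearEquiv 2 ℝ (V → ℝ))
  refine congrFun (eigenvalues₀_eq_of_basis (meanAveragingMatrix_isHermitian p)
    (l := fun i => 1 - hA.eigenvalues₀ i.rev / 2) (fun i j hij => ?_) b fun i => ?_) i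
  · have := hA.eigenvalues₀_antitone (Fin.rev_le_rev.2 hij)
    simp only
    linarith
  · have hbi : b i = (hA.eigenvectorBasis (eigenIndex V i.rev)).ofLp := by simp [b]
    rw [hbi, hp.meanAveragingMatrix_eq, Matrix.sub_mulVec, Matrix.one_mulVec, Matrix.smul_mulVec,
      mulVec_eigenvectorBasis_eigenIndex]
    module

variable [Nontrivial V]

theorem exists_laplacian_mulVec_eq_spectralGap_smul (p : Sym2 V → ℝ) :
    ∃ v, l2norm v = 1 ∧ laplacian p *ᵥ v = spectralGap p • v :=
  ⟨_, (laplacian_isHermitian p).eigenvectorBasis.norm_eq_one _,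
    mulVec_eigenvectorBasis_eigenIndex (laplacian_isHermitian p) _⟩

namespace IsEdgeDistribution

theorem spectralGap_pos (hp : IsEdgeDistribution G p) (hG : G.Preconnected) :
    0 < spectralGap p := by
  by_contra! hc
  have hcard := Fintype.one_lt_card (α := V)
  have hA := laplacian_isHermitian p
  have hconst : ∀ i : Fin (Fintype.card V), Fintype.card V - 2 ≤ i.1 → ∀ k l,
      hA.eigenvectorBasis (eigenIndex V i) k = hA.eigenvectorBasis (eigenIndex V i) l := by
    intro i hi
    apply hp.eq_of_dotProduct_laplacian_mulVec_nonpos hG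
    rw [mulVec_eigenvectorBasis_eigenIndex, dotProduct_smul, dotProduct_self_eq_l2norm_sq]
    exact mul_nonpos_of_nonpos_of_nonneg
      ((hA.eigenvalues₀_antitone (Fin.mk_le_of_le_val hi)).trans hc) (sq_nonneg _)
  refine not_const_of_orthonormal hA.eigenvectorBasis.orthonormal
    (i := eigenIndex V ⟨Fintype.card V - 2, by omega⟩)
    (j := eigenIndex V ⟨Fintype.card V - 1, by omega⟩) ?_ (hconst _ le_rfl)
    (hconst _ (Nat.sub_le_sub_left one_le_two _))
  rw [ne_eq, EmbeddingLike.apply_eq_iff_eq, Fin.mk.injEq]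
  omega

theorem spectralGap_mul_l2norm_sq_le (hp : IsEdgeDistribution G p) (hG : G.Preconnected)
    {x : V → ℝ} (hx : ∑ k, x k = 0) :
    spectralGap p * l2norm x ^ 2 ≤ x ⬝ᵥ laplacian p *ᵥ x := by
  have hcard := Fintype.one_lt_card (α := V)
  have hA := laplacian_isHermitian p
  have hone : (toLp 2 fun _ => 1 : EuclideanSpace ℝ V) ≠ 0 := fun h => by
    obtain ⟨k⟩ := (inferInstance : Nonempty V)
    simpa using congr($h k)
  have hker : (laplacian p).toEuclideanLin (toLp 2 fun _ => 1) =
      (0 : ℝ) • (toLp 2 fun _ => 1 : EuclideanSpace ℝ V) := by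
    rw [Matrix.toLpLin_apply, laplacian_mulVec_const, zero_smul]; rfl
  have hbound : ∀ i ≠ eigenIndex V ⟨Fintype.card V - 1, by omega⟩,
      spectralGap p ≤ hA.eigenvalues i := by
    intro i hi
    obtain ⟨j, rfl⟩ := (eigenIndex V).surjective i
    have hj : j.1 ≠ Fintype.card V - 1 := fun h => hi (congrArg _ (Fin.ext h))
    rw [eigenvalues_eigenIndex]
    exact hA.eigenvalues₀_antitone (Fin.le_def.2 (by simp only; omega))
  have h := mul_norm_sq_le_inner_map hA.eigenvectorBasis
    (T := (laplacian p).toEuclideanLin)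
    (fun i => congrArg (toLp 2) (hA.mulVec_eigenvectorBasis i)) hbound (hp.spectralGap_pos hG) hone
    hker (x := toLp 2 x) (by simpa [PiLp.inner_apply] using hx)
  rwa [Matrix.toLpLin_toLp, EuclideanSpace.inner_toLp_toLp, star_trivial,
    dotProduct_comm] at h

theorem spectralGap_mul_l2norm_le (hp : IsEdgeDistribution G p) (hG : G.Preconnected)
    {x : V → ℝ} (hx : ∑ k, x k = 0) : spectralGap p * l2norm x ≤ l2norm (laplacian p *ᵥ x) := by
  rcases (l2norm_nonneg x).eq_or_lt with h | h
  · rw [← h, mul_zero]; exact l2norm_nonneg _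
  · refine le_of_mul_le_mul_right ?_ h
    calc spectralGap p * l2norm x * l2norm x = spectralGap p * l2norm x ^ 2 := by ring
      _ ≤ x ⬝ᵥ laplacian p *ᵥ x := hp.spectralGap_mul_l2norm_sq_le hG hx
      _ ≤ l2norm (laplacian p *ᵥ x) * l2norm x :=
        (dotProduct_le_l2norm_mul_l2norm _ _).trans_eq (mul_comm _ _)

theorem spectralGap_le_two (hp : IsEdgeDistribution G p) : spectralGap p ≤ 2 := by
  obtain ⟨v, hv, hLv⟩ := exists_laplacian_mulVec_eq_spectralGap_smul p
  have h := hp.dotProduct_laplacian_mulVec_le v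
  rw [hLv, dotProduct_smul, dotProduct_self_eq_l2norm_sq, hv] at h
  simpa using h

theorem spectralGap_eq_two_of_card_eq_two (hp : IsEdgeDistribution G p) (hG : G.Preconnected)
    (hV : Fintype.card V = 2) : spectralGap p = 2 := by
  obtain ⟨v, hv, hLv⟩ := exists_laplacian_mulVec_eq_spectralGap_smul p
  have hv₀ : v ≠ 0 := by rintro rfl; simp [l2norm] at hv
  have hsum : ∑ k, v k = 0 := by
    have h := sum_laplacian_mulVec p v
    simp only [hLv, Pi.smul_apply, smul_eq_mul, ← Finset.mul_sum] at h
    exact (mul_eq_zero.1 h).resolve_left (hp.spectralGap_pos hG).ne'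
  rw [hp.laplacian_mulVec_of_card_eq_two hV hsum] at hLv
  exact smul_left_injective ℝ hv₀ hLv.symm

theorem lambdaTwo_eq (hp : IsEdgeDistribution G p) : lambdaTwo p = 1 - spectralGap p / 2 := by
  rw [lambdaTwo, hp.eigenvalues₀_meanAveragingMatrix, spectralGap]
  congr

theorem dotProduct_meanAveragingMatrix_mulVec_le (hp : IsEdgeDistribution G p)
    (hG : G.Preconnected) {x : V → ℝ} (hx : ∑ k, x k = 0) :
    x ⬝ᵥ meanAveragingMatrix p *ᵥ x ≤ lambdaTwo p * l2norm x ^ 2 := by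
  have h := hp.spectralGap_mul_l2norm_sq_le hG hx
  rw [hp.lambdaTwo_eq, hp.meanAveragingMatrix_eq, Matrix.sub_mulVec, Matrix.one_mulVec,
    Matrix.smul_mulVec, dotProduct_sub, dotProduct_smul, dotProduct_self_eq_l2norm_sq, smul_eq_mul]
  linarith

theorem one_sub_cTilde_sq (hp : IsEdgeDistribution G p) : (1 - cTilde p) ^ 2 = lambdaTwo p := by
  rw [cTilde, sub_sub_cancel, Real.sq_sqrt]
  linarith [hp.lambdaTwo_eq, hp.spectralGap_le_two]

theorem cTilde_pos (hp : IsEdgeDistribution G p) (hG : G.Preconnected) : 0 < cTilde p := by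
  rw [cTilde, sub_pos, Real.sqrt_lt' one_pos]
  linarith [hp.lambdaTwo_eq, hp.spectralGap_pos hG]

theorem cTilde_eq_one_of_card_eq_two (hp : IsEdgeDistribution G p) (hG : G.Preconnected)
    (hV : Fintype.card V = 2) : cTilde p = 1 := by
  rw [cTilde, hp.lambdaTwo_eq, hp.spectralGap_eq_two_of_card_eq_two hG hV]
  simp

end IsEdgeDistribution

theorem cTilde_le_one (p : Sym2 V → ℝ) : cTilde p ≤ 1 :=
  sub_le_self _ (Real.sqrt_nonneg _)

namespace IsEdgeDistribution

theorem abs_sum_orbit_le (hp : IsEdgeDistribution G p) (hG : G.Preconnected) {f : ℕ → V → ℝ}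
    (h₀ : ∑ k, f 0 k = 0) (hf : ∀ d, f (d + 1) = f d - laplacian p *ᵥ f d) (D : ℕ) (k : V) :
    |∑ d ∈ Finset.range D, f d k| ≤ 2 * l2norm (f 0) / spectralGap p := by
  have hsum : ∀ d, ∑ k, f d k = 0 := fun d => by
    induction d with
    | zero => exact h₀
    | succ d ih => simp [hf, ih, sum_laplacian_mulVec]
  have hnorm : ∀ d, l2norm (f d) ≤ l2norm (f 0) := fun d => by
    induction d with
    | zero => rfl
    | succ d ih => rw [hf]; exact (hp.l2norm_sub_laplacian_mulVec_le _).trans ih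
  set g : V → ℝ := ∑ d ∈ Finset.range D, f d with hg
  have htelescope : laplacian p *ᵥ g = f 0 - f D := by
    rw [hg, Matrix.mulVec_sum, ← Finset.sum_range_sub' f D]
    exact Finset.sum_congr rfl fun d _ => by rw [hf]; abel
  have hgsum : ∑ k, g k = 0 := by
    simp only [hg, Finset.sum_apply]
    rw [Finset.sum_comm]
    simp only [hsum, Finset.sum_const_zero]
  rw [← Finset.sum_apply, le_div_iff₀' (hp.spectralGap_pos hG)]
  calc spectralGap p * |g k| ≤ spectralGap p * l2norm g :=
        mul_le_mul_of_nonneg_left (abs_apply_le_l2norm g k) (hp.spectralGap_pos hG).le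
    _ ≤ l2norm (laplacian p *ᵥ g) := hp.spectralGap_mul_l2norm_le hG hgsum
    _ ≤ l2norm (f 0) + l2norm (f D) := htelescope ▸ l2norm_sub_le _ _
    _ ≤ 2 * l2norm (f 0) := by linarith [hnorm D]

end IsEdgeDistribution

end Gap

/-! ### Mean squares of random vectors -/

section MeanSquare

variable [Fintype V] {Ω : Type*} [MeasurableSpace Ω] {μ : Measure Ω} {f g : Ω → V → ℝ}

/-- The root mean square `√(𝔼 ‖f‖²)` of a random vector. -/
noncomputable def rms (μ : Measure Ω) (f : Ω → V → ℝ) : ℝ := √(∫ ω, l2norm (f ω) ^ 2 ∂μ)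

theorem rms_nonneg (μ : Measure Ω) (f : Ω → V → ℝ) : 0 ≤ rms μ f := Real.sqrt_nonneg _

theorem rms_sq (μ : Measure Ω) (f : Ω → V → ℝ) : rms μ f ^ 2 = ∫ ω, l2norm (f ω) ^ 2 ∂μ :=
  Real.sq_sqrt (integral_nonneg fun _ => sq_nonneg _)

theorem rms_le_of_integral_le {y : ℝ} (hy : 0 ≤ y) (h : ∫ ω, l2norm (f ω) ^ 2 ∂μ ≤ y ^ 2) :
    rms μ f ≤ y :=
  Real.sqrt_le_iff.2 ⟨hy, h⟩

theorem rms_eq_lpNorm (hf : AEStronglyMeasurable (fun ω => toLp 2 (f ω)) μ) :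
    rms μ f = lpNorm (fun ω => toLp 2 (f ω)) 2 μ := by
  simp [lpNorm_eq_integral_norm_rpow_toReal two_ne_zero ENNReal.ofNat_ne_top hf, rms, l2norm,
    Real.sqrt_eq_rpow]

theorem rms_add_le (hf : MemLp (fun ω => toLp 2 (f ω)) 2 μ)
    (hg : MemLp (fun ω => toLp 2 (g ω)) 2 μ) :
    rms μ (fun ω => f ω + g ω) ≤ rms μ f + rms μ g := by
  have hfg : AEStronglyMeasurable (fun ω => toLp 2 (f ω + g ω)) μ := hf.1.add hg.1
  rw [rms_eq_lpNorm hf.1, rms_eq_lpNorm hg.1, rms_eq_lpNorm hfg]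
  exact lpNorm_add_le hf one_le_two

theorem rms_sub_le (hf : MemLp (fun ω => toLp 2 (f ω)) 2 μ)
    (hg : MemLp (fun ω => toLp 2 (g ω)) 2 μ) :
    rms μ (fun ω => f ω - g ω) ≤ rms μ f + rms μ g := by
  have hfg : AEStronglyMeasurable (fun ω => toLp 2 (f ω - g ω)) μ := hf.1.sub hg.1
  rw [rms_eq_lpNorm hf.1, rms_eq_lpNorm hg.1, rms_eq_lpNorm hfg]
  exact lpNorm_sub_le hf one_le_two

theorem rms_mono (hg : MemLp (fun ω => toLp 2 (g ω)) 2 μ)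
    (h : ∀ ω, l2norm (f ω) ≤ l2norm (g ω)) : rms μ f ≤ rms μ g :=
  Real.sqrt_le_sqrt <| integral_mono_of_nonneg (ae_of_all _ fun _ => sq_nonneg _)
    (hg.integrable_norm_pow two_ne_zero)
    (ae_of_all _ fun ω => pow_le_pow_left₀ (l2norm_nonneg _) (h ω) 2)

theorem integral_l2norm_le_rms [IsProbabilityMeasure μ]
    (hf : MemLp (fun ω => toLp 2 (f ω)) 2 μ) : ∫ ω, l2norm (f ω) ∂μ ≤ rms μ f := by
  rw [rms_eq_lpNorm hf.1, ← toReal_eLpNorm hf.1]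
  change ∫ ω, ‖toLp 2 (f ω)‖ ∂μ ≤ _
  rw [← lpNorm_one_eq_integral_norm hf.1, ← toReal_eLpNorm hf.1]
  exact ENNReal.toReal_mono hf.2.ne (eLpNorm_le_eLpNorm_of_exponent_le one_le_two hf.1)

theorem l2norm_integral_le (hf : ∀ k, Integrable (f · k) μ) :
    l2norm (fun k => ∫ ω, f ω k ∂μ) ≤ ∫ ω, l2norm (f ω) ∂μ := by
  have h : toLp 2 (fun k => ∫ ω, f ω k ∂μ) = ∫ ω, toLp 2 (f ω) ∂μ :=
    PiLp.ext fun k => (eval_integral_piLp (f := fun ω => toLp 2 (f ω)) hf k).symm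
  rw [l2norm, h]
  exact norm_integral_le_integral_norm _

end MeanSquare

/-! ### Independence of the past -/

section DependsOn

variable {ι β γ δ : Type*} {A : ι → Type*} {s : Set ι} {f : (∀ i, A i) → β} {g : (∀ i, A i) → γ}

theorem dependsOn_comp (φ : β → γ) (hf : DependsOn f s) : DependsOn (fun x => φ (f x)) s :=
  fun _ _ h => congrArg φ (hf h)

theorem dependsOn_comp₂ (φ : β → γ → δ) (hf : DependsOn f s) (hg : DependsOn g s) :
    DependsOn (fun x => φ (f x) (g x)) s :=
  fun _ _ h => congrArg₂ φ (hf h) (hg h)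

theorem dependsOn_Iic_succ {A : ℕ → Type*} {f : (∀ i, A i) → β} {t : ℕ}
    (hf : DependsOn f (Set.Iic t)) : DependsOn f (Set.Iic (t + 1)) :=
  hf.mono (Set.Iic_subset_Iic.2 t.le_succ)

theorem dependsOn_apply_Iic {A : ℕ → Type*} (t : ℕ) :
    DependsOn (fun x : ∀ i, A i => x t) (Set.Iic t) :=
  fun _ _ h => h t (Set.mem_Iic.2 le_rfl)

end DependsOn

namespace IsEdgeSampling

variable {Ω : Type*} [MeasurableSpace Ω] {μ : Measure Ω} {p : Sym2 V → ℝ}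
  {ξ : ℕ → Ω → Sym2 V}

section Finite

variable [Finite V]

theorem setIntegral_eq (h : IsEdgeSampling μ p ξ) {t : ℕ} {F : (ℕ → Sym2 V) → ℝ}
    (hF : DependsOn F (Set.Iic t)) (e : Sym2 V) :
    ∫ ω in ξ (t + 1) ⁻¹' {e}, F (ξ · ω) ∂μ = p e * ∫ ω, F (ξ · ω) ∂μ := by
  let _ : MeasurableSpace (Sym2 V) := ⊤
  have : MeasurableSingletonClass (Sym2 V) := ⟨fun _ => trivial⟩
  rw [← Finset.coe_Iic] at hF
  obtain ⟨g, rfl⟩ := dependsOn_iff_exists_comp.1 hF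
  have hind := h.indep.indepFun_finset {t + 1} (Finset.Iic t) (by simp) h.measurable
  rw [← h.law (t + 1) e]
  have hξ : ∀ S : Finset ℕ, Measurable fun ω (i : S) => ξ i ω :=
    fun S => measurable_pi_lambda _ fun i => h.measurable i
  exact Indep.setIntegral_eq_mul (f := g) (X := fun ω (i : Finset.Iic t) => ξ i ω)
    (hξ {t + 1}).comap_le ((IndepFun_iff_Indep _ _ _).1 hind) (hξ _).aemeasurable
    ⟨{y | y ⟨t + 1, Finset.mem_singleton_self _⟩ = e}, .of_discrete, rfl⟩
    StronglyMeasurable.of_discrete.aestronglyMeasurable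

variable [IsFiniteMeasure μ]

theorem memLp {E : Type*} [NormedAddCommGroup E] (h : IsEdgeSampling μ p ξ) {t : ℕ}
    {F : (ℕ → Sym2 V) → E} (hF : DependsOn F (Set.Iic t)) (q : ENNReal) :
    MemLp (fun ω => F (ξ · ω)) q μ := by
  let _ : MeasurableSpace (Sym2 V) := ⊤
  have : MeasurableSingletonClass (Sym2 V) := ⟨fun _ => trivial⟩
  obtain ⟨g, rfl⟩ := dependsOn_iff_exists_comp.1 hF
  have hξ : Measurable fun ω (i : Set.Iic t) => ξ i ω :=
    measurable_pi_lambda _ fun i => h.measurable i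
  obtain ⟨C, hC⟩ := Finite.exists_le fun y => ‖g y‖
  exact MemLp.of_bound ((StronglyMeasurable.of_discrete (f := g)).comp_measurable hξ
    |>.aestronglyMeasurable) C (ae_of_all _ fun ω => hC _)

theorem integrable (h : IsEdgeSampling μ p ξ) {t : ℕ} {F : (ℕ → Sym2 V) → ℝ}
    (hF : DependsOn F (Set.Iic t)) : Integrable (fun ω => F (ξ · ω)) μ :=
  memLp_one_iff_integrable.1 (h.memLp hF 1)

end Finite

theorem integral_next [Fintype V] [IsFiniteMeasure μ]
    (h : IsEdgeSampling μ p ξ) {t : ℕ} {F : (ℕ → Sym2 V) → Sym2 V → ℝ}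
    (hF : ∀ e, DependsOn (F · e) (Set.Iic t)) :
    ∫ ω, F (ξ · ω) (ξ (t + 1) ω) ∂μ = ∑ e, p e * ∫ ω, F (ξ · ω) e ∂μ := by
  have hint : Integrable (fun ω => F (ξ · ω) (ξ (t + 1) ω)) μ :=
    h.integrable (F := fun x => F x (x (t + 1)))
      (dependsOn_comp₂ (fun y e => y e)
        (fun x y hxy => funext fun e => dependsOn_Iic_succ (hF e) hxy)
        (dependsOn_apply_Iic (t + 1)))
  have hmeas : ∀ e, MeasurableSet (ξ (t + 1) ⁻¹' {e}) := fun e => h.measurable (t + 1) trivial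
  have hcover : ⋃ e, ξ (t + 1) ⁻¹' {e} = Set.univ := by
    rw [← Set.preimage_iUnion, Set.iUnion_of_singleton, Set.preimage_univ]
  rw [← setIntegral_univ, ← hcover, integral_iUnion_fintype hmeas
    (fun e e' hne => (Set.disjoint_singleton.2 hne).preimage _) fun e => hint.integrableOn]
  refine Finset.sum_congr rfl fun e _ => ?_
  rw [← h.setIntegral_eq (hF e) e]
  exact setIntegral_congr_fun (hmeas e) fun ω hω => congrArg (F (ξ · ω)) hω

end IsEdgeSampling

section Algorithm

variable [DecidableEq V]

theorem dependsOn_auxObs (X : V → ℝ) (t : ℕ) :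
    DependsOn (fun e => auxObs X e t) (Set.Iic t) := by
  induction t with
  | zero => exact fun _ _ _ => rfl
  | succ t ih =>
    exact dependsOn_comp₂ (fun Y e => Y ∘ swapEdge e) (dependsOn_Iic_succ ih)
      (dependsOn_apply_Iic (t + 1))

theorem normRankEst_succ (X : V → ℝ) (e : ℕ → Sym2 V) (t : ℕ) (k : V) :
    normRankEst X e (t + 1) k = (1 - 1 / ((t + 1 : ℕ) : ℝ)) * normRankEst X e t k +
      1 / ((t + 1 : ℕ) : ℝ) * (if auxObs X e t k < X k then 1 else 0) := by
  rw [normRankEst]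

theorem dependsOn_normRankEst_succ (X : V → ℝ) (t : ℕ) :
    DependsOn (fun e => normRankEst X e (t + 1)) (Set.Iic t) := by
  induction t with
  | zero => exact fun _ _ _ => rfl
  | succ t ih =>
    intro x y hxy
    have hR : normRankEst X x (t + 1) = normRankEst X y (t + 1) := dependsOn_Iic_succ ih hxy
    have hY : auxObs X x (t + 1) = auxObs X y (t + 1) := dependsOn_auxObs X (t + 1) hxy
    funext k
    simp only [normRankEst_succ _ _ (t + 1), hR, hY]

variable [Fintype V]

theorem dependsOn_weight_succ (α : ℝ) (X : V → ℝ) (t : ℕ) :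
    DependsOn (fun e => weight α X e (t + 1)) (Set.Iic t) :=
  dependsOn_comp (fun R k => weightFun V α (Fintype.card V * R k + 1))
    (dependsOn_normRankEst_succ X t)

theorem dependsOn_weight (α : ℝ) (X : V → ℝ) (t : ℕ) :
    DependsOn (fun e => weight α X e t) (Set.Iic t) := by
  cases t with
  | zero => exact fun _ _ _ => rfl
  | succ t => exact dependsOn_Iic_succ (dependsOn_weight_succ α X t)

theorem dependsOn_weight_sub (α : ℝ) (X : V → ℝ) (t : ℕ) :
    DependsOn (fun e => weight α X e (t + 1) - weight α X e t) (Set.Iic t) :=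
  dependsOn_comp₂ (· - ·) (dependsOn_weight_succ α X t) (dependsOn_weight α X t)

theorem dependsOn_estimate (α : ℝ) (X : V → ℝ) (t : ℕ) :
    DependsOn (fun e => estimate α X e t) (Set.Iic t) := by
  induction t with
  | zero => exact fun _ _ _ => rfl
  | succ t ih =>
    exact dependsOn_comp₂ (fun v e => averagingMatrix e *ᵥ v)
      (dependsOn_Iic_succ (dependsOn_comp₂ (fun N W => N + W * X) ih
        (dependsOn_weight_sub α X t)))
      (dependsOn_apply_Iic (t + 1))

end Algorithm

/-! ### Accuracy of the rank estimates -/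

section Comparison

theorem exists_auxObs_eq_comp_perm [DecidableEq V] (X : V → ℝ) (e : ℕ → Sym2 V) (t : ℕ) :
    ∃ f : Equiv.Perm V, auxObs X e t = X ∘ f := by
  induction t with
  | zero => exact ⟨1, rfl⟩
  | succ t ih =>
    obtain ⟨f, hf⟩ := ih
    exact ⟨(swapEdge (e (t + 1))).trans f, funext fun k => congrFun hf (swapEdge (e (t + 1)) k)⟩

variable [Fintype V] (X : V → ℝ) (k : V)

/-- The normalized rank `u_k = (r_k - 1) / n`. -/
noncomputable def normRank : ℝ := ((rank X k : ℝ) - 1) / (Fintype.card V : ℝ)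

/-- The vector of centred outcomes `𝕀{X_k > Y_l(s)} - u_k`: its entry at `k` is the fluctuation
of the comparison made at node `k` at iteration `s + 1`, and the exchanges permute its entries. -/
noncomputable def comparison [DecidableEq V] (e : ℕ → Sym2 V) (s : ℕ) (l : V) : ℝ :=
  (if auxObs X e s l < X k then 1 else 0) - normRank X k

theorem normRank_eq : normRank X k =
    ((Finset.univ.filter fun l => X l < X k).card : ℝ) / Fintype.card V := by
  simp [normRank, rank]

theorem normRank_nonneg : 0 ≤ normRank X k := by
  rw [normRank_eq]
  positivity

theorem normRank_lt_one : normRank X k < 1 := by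
  rw [normRank_eq, div_lt_one (Nat.cast_pos.2 (Fintype.card_pos_iff.2 ⟨k⟩)), Nat.cast_lt]
  exact Finset.card_lt_univ_of_notMem (x := k) (by simp)

theorem normRank_pos {X : V → ℝ} {k l : V} (h : X l < X k) : 0 < normRank X k := by
  rw [normRank_eq]
  exact div_pos (Nat.cast_pos.2 (Finset.card_pos.2 ⟨l, by simpa using h⟩))
    (Nat.cast_pos.2 (Fintype.card_pos_iff.2 ⟨k⟩))

theorem sum_ite_lt : ∑ l, (if X l < X k then (1 : ℝ) else 0) = Fintype.card V * normRank X k := by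
  have hn : (Fintype.card V : ℝ) ≠ 0 := Nat.cast_ne_zero.2 (Fintype.card_pos_iff.2 ⟨k⟩).ne'
  rw [Finset.sum_boole, normRank_eq, mul_div_cancel₀ _ hn]

theorem rankSigma_sq : rankSigma (Fintype.card V) (rank X k) ^ 2 =
    (Fintype.card V : ℝ) ^ 3 * (normRank X k * (1 - normRank X k)) := by
  have hpow : ((Fintype.card V : ℝ) ^ (3 / 2 : ℝ)) ^ 2 = (Fintype.card V : ℝ) ^ 3 := by
    rw [← Real.rpow_natCast, ← Real.rpow_mul (Nat.cast_nonneg _)]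
    norm_num
  have hscore : score (((rank X k : ℝ) - 1) / Fintype.card V) ^ 2 =
      normRank X k * (1 - normRank X k) :=
    Real.sq_sqrt (mul_nonneg (normRank_nonneg X k) (sub_nonneg.2 (normRank_lt_one X k).le))
  rw [rankSigma, mul_pow, hscore, hpow]

variable [DecidableEq V]

theorem exists_comparison_eq_comp_perm (e : ℕ → Sym2 V) (s : ℕ) : ∃ f : Equiv.Perm V,
    comparison X k e s = (fun l => (if X l < X k then 1 else 0) - normRank X k) ∘ f := by
  obtain ⟨f, hf⟩ := exists_auxObs_eq_comp_perm X e s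
  refine ⟨f, ?_⟩
  funext l
  simp only [comparison, hf, Function.comp_apply]

theorem sum_comparison (e : ℕ → Sym2 V) (s : ℕ) : ∑ l, comparison X k e s l = 0 := by
  obtain ⟨f, hf⟩ := exists_comparison_eq_comp_perm X k e s
  rw [hf]
  refine (Equiv.sum_comp f fun l => (if X l < X k then (1 : ℝ) else 0) - normRank X k).trans ?_
  rw [Finset.sum_sub_distrib, sum_ite_lt, Finset.sum_const, Finset.card_univ, nsmul_eq_mul,
    sub_self]

theorem l2norm_sq_comparison (e : ℕ → Sym2 V) (s : ℕ) :
    l2norm (comparison X k e s) ^ 2 =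
      Fintype.card V * (normRank X k * (1 - normRank X k)) := by
  obtain ⟨f, hf⟩ := exists_comparison_eq_comp_perm X k e s
  have hterm : ∀ l, ((if X l < X k then (1 : ℝ) else 0) - normRank X k) ^ 2 =
      (1 - 2 * normRank X k) * (if X l < X k then (1 : ℝ) else 0) + normRank X k ^ 2 := by
    intro l
    split_ifs <;> ring
  rw [hf, l2norm_comp_perm, l2norm_sq]
  simp only [hterm, Finset.sum_add_distrib, ← Finset.mul_sum, sum_ite_lt, Finset.sum_const,
    Finset.card_univ, nsmul_eq_mul]
  ring

theorem mul_normRankEst_sub (e : ℕ → Sym2 V) (t : ℕ) :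
    t * (normRankEst X e t k - normRank X k) = ∑ s ∈ Finset.range t, comparison X k e s k := by
  induction t with
  | zero => simp
  | succ t ih =>
    have ht : (t : ℝ) + 1 ≠ 0 := by positivity
    rw [Finset.sum_range_succ, ← ih, normRankEst_succ, comparison]
    push_cast
    field_simp
    ring

theorem rankEst_sub_rank (e : ℕ → Sym2 V) {t : ℕ} (ht : t ≠ 0) :
    rankEst X e t k - rank X k =
      Fintype.card V / t * ∑ s ∈ Finset.range t, comparison X k e s k := by
  have hn : (Fintype.card V : ℝ) ≠ 0 := Nat.cast_ne_zero.2 (Fintype.card_pos_iff.2 ⟨k⟩).ne'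
  rw [← mul_normRankEst_sub, rankEst, normRank]
  field_simp
  ring

theorem dependsOn_comparison (s : ℕ) : DependsOn (fun e => comparison X k e s) (Set.Iic s) :=
  dependsOn_comp (fun Y l => (if Y l < X k then 1 else 0) - normRank X k) (dependsOn_auxObs X s)

theorem dependsOn_comparison_mul_comparison (s d : ℕ) (l : V) :
    DependsOn (fun e => comparison X k e s k * comparison X k e (s + d) l)
      (Set.Iic (s + d)) :=
  dependsOn_comp₂ (fun c c' => c k * c' l)
    ((dependsOn_comparison X k s).mono (Set.Iic_subset_Iic.2 (Nat.le_add_right s d)))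
    (dependsOn_comparison X k (s + d))

end Comparison

theorem sq_sum_range_le_two_mul_sum_lag (a : ℕ → ℝ) (t : ℕ) :
    (∑ s ∈ Finset.range t, a s) ^ 2 ≤
      2 * ∑ s ∈ Finset.range t, ∑ d ∈ Finset.range (t - s), a s * a (s + d) := by
  induction t with
  | zero => simp
  | succ t ih =>
    have h : ∑ s ∈ Finset.range (t + 1), ∑ d ∈ Finset.range (t + 1 - s), a s * a (s + d) =
        ∑ s ∈ Finset.range t, ∑ d ∈ Finset.range (t - s), a s * a (s + d) +
          (∑ s ∈ Finset.range t, a s) * a t + a t ^ 2 := by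
      rw [Finset.sum_range_succ, Finset.sum_mul, ← Finset.sum_add_distrib]
      congr 1
      · refine Finset.sum_congr rfl fun s hs => ?_
        have hs' := (Finset.mem_range.1 hs).le
        rw [Nat.succ_sub hs', Finset.sum_range_succ, Nat.add_sub_cancel' hs']
      · simp [sq]
    rw [h, Finset.sum_range_succ]
    nlinarith [sq_nonneg (a t)]

namespace IsEdgeSampling

variable [Fintype V] [DecidableEq V] {Ω : Type*} [MeasurableSpace Ω] {μ : Measure Ω}
  [IsProbabilityMeasure μ] {p : Sym2 V → ℝ} {ξ : ℕ → Ω → Sym2 V} {G : SimpleGraph V}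

theorem integral_mul_comparison_succ (h : IsEdgeSampling μ p ξ) (hp : IsEdgeDistribution G p)
    (X : V → ℝ) (k : V) (s d : ℕ) :
    (fun l => ∫ ω, comparison X k (ξ · ω) s k * comparison X k (ξ · ω) (s + (d + 1)) l ∂μ) =
      (fun l => ∫ ω, comparison X k (ξ · ω) s k * comparison X k (ξ · ω) (s + d) l ∂μ) -
        laplacian p *ᵥ
          fun l => ∫ ω, comparison X k (ξ · ω) s k * comparison X k (ξ · ω) (s + d) l ∂μ := by
  rw [← hp.sum_smul_comp_swapEdge]
  funext l
  simp only [Finset.sum_apply, Pi.smul_apply, Function.comp_apply, smul_eq_mul]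
  exact h.integral_next
    (F := fun x e => comparison X k x s k * comparison X k x (s + d) (swapEdge e l))
    fun e => dependsOn_comparison_mul_comparison X k s d (swapEdge e l)

theorem l2norm_integral_mul_comparison_le (h : IsEdgeSampling μ p ξ) (X : V → ℝ) (k : V)
    (s : ℕ) :
    l2norm (fun l => ∫ ω, comparison X k (ξ · ω) s k * comparison X k (ξ · ω) s l ∂μ) ≤
      Fintype.card V * (normRank X k * (1 - normRank X k)) := by
  have hbound : ∀ ω, l2norm (comparison X k (ξ · ω) s k • comparison X k (ξ · ω) s) ≤
      Fintype.card V * (normRank X k * (1 - normRank X k)) := fun ω => by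
    rw [l2norm_smul, ← l2norm_sq_comparison X k (ξ · ω) s, sq]
    exact mul_le_mul_of_nonneg_right (abs_apply_le_l2norm _ k) (l2norm_nonneg _)
  refine (l2norm_integral_le
    (f := fun ω => comparison X k (ξ · ω) s k • comparison X k (ξ · ω) s)
    fun l => h.integrable (dependsOn_comparison_mul_comparison X k s 0 l)).trans ?_
  refine (integral_mono_of_nonneg (ae_of_all _ fun _ => l2norm_nonneg _) (integrable_const _)
    (ae_of_all _ hbound)).trans_eq ?_
  simp

variable [Nontrivial V]

theorem sum_integral_mul_comparison_le (h : IsEdgeSampling μ p ξ)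
    (hp : IsEdgeDistribution G p) (hG : G.Preconnected) (X : V → ℝ) (k : V) (s D : ℕ) :
    ∑ d ∈ Finset.range D,
        ∫ ω, comparison X k (ξ · ω) s k * comparison X k (ξ · ω) (s + d) k ∂μ ≤
      2 * (Fintype.card V * (normRank X k * (1 - normRank X k))) / spectralGap p := by
  have hgap := hp.spectralGap_pos hG
  have hsum : ∑ l, ∫ ω, comparison X k (ξ · ω) s k * comparison X k (ξ · ω) (s + 0) l ∂μ = 0 := by
    rw [← integral_finsetSum _ fun l _ =>
      h.integrable (dependsOn_comparison_mul_comparison X k s 0 l)]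
    simp only [← Finset.mul_sum, sum_comparison, mul_zero, integral_zero]
  refine (le_abs_self _).trans ((hp.abs_sum_orbit_le hG (f := fun d l =>
    ∫ ω, comparison X k (ξ · ω) s k * comparison X k (ξ · ω) (s + d) l ∂μ) hsum
    (h.integral_mul_comparison_succ hp X k s) D k).trans ?_)
  gcongr
  exact h.l2norm_integral_mul_comparison_le X k s

theorem integral_sq_sum_comparison_le (h : IsEdgeSampling μ p ξ) (hp : IsEdgeDistribution G p)
    (hG : G.Preconnected) (X : V → ℝ) (k : V) (t : ℕ) :
    ∫ ω, (∑ s ∈ Finset.range t, comparison X k (ξ · ω) s k) ^ 2 ∂μ ≤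
      4 * t * (Fintype.card V * (normRank X k * (1 - normRank X k))) / spectralGap p := by
  set B := (Fintype.card V : ℝ) * (normRank X k * (1 - normRank X k))
  have hint : ∀ s d, Integrable
      (fun ω => comparison X k (ξ · ω) s k * comparison X k (ξ · ω) (s + d) k) μ :=
    fun s d => h.integrable (dependsOn_comparison_mul_comparison X k s d k)
  have hint' : ∀ s, Integrable (fun ω => ∑ d ∈ Finset.range (t - s),
      comparison X k (ξ · ω) s k * comparison X k (ξ · ω) (s + d) k) μ :=
    fun s => integrable_finsetSum _ fun d _ => hint s d
  calc ∫ ω, (∑ s ∈ Finset.range t, comparison X k (ξ · ω) s k) ^ 2 ∂μ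
    _ ≤ ∫ ω, 2 * ∑ s ∈ Finset.range t, ∑ d ∈ Finset.range (t - s),
          comparison X k (ξ · ω) s k * comparison X k (ξ · ω) (s + d) k ∂μ :=
        integral_mono_of_nonneg (ae_of_all _ fun ω => sq_nonneg _)
          ((integrable_finsetSum _ fun s _ => hint' s).const_mul 2)
          (ae_of_all _ fun ω => sq_sum_range_le_two_mul_sum_lag _ t)
    _ = 2 * ∑ s ∈ Finset.range t, ∑ d ∈ Finset.range (t - s),
          ∫ ω, comparison X k (ξ · ω) s k * comparison X k (ξ · ω) (s + d) k ∂μ := by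
        rw [integral_const_mul, integral_finsetSum _ fun s _ => hint' s]
        simp only [integral_finsetSum _ fun d _ => hint _ d]
    _ ≤ 2 * ∑ _s ∈ Finset.range t, 2 * B / spectralGap p := by
        gcongr with s
        exact h.sum_integral_mul_comparison_le hp hG X k s (t - s)
    _ = 4 * t * B / spectralGap p := by
        rw [Finset.sum_const, Finset.card_range, nsmul_eq_mul]
        ring

theorem integral_sq_rankEst_sub_le (h : IsEdgeSampling μ p ξ) (hp : IsEdgeDistribution G p)
    (hG : G.Preconnected) (X : V → ℝ) (k : V) {t : ℕ} (ht : t ≠ 0) :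
    ∫ ω, (rankEst X (ξ · ω) t k - rank X k) ^ 2 ∂μ ≤
      4 * rankSigma (Fintype.card V) (rank X k) ^ 2 / (spectralGap p * t) := by
  have hgap := hp.spectralGap_pos hG
  simp only [rankEst_sub_rank X k _ ht, mul_pow]
  rw [integral_const_mul, rankSigma_sq]
  calc (Fintype.card V / t : ℝ) ^ 2 *
        ∫ ω, (∑ s ∈ Finset.range t, comparison X k (ξ · ω) s k) ^ 2 ∂μ
      ≤ (Fintype.card V / t : ℝ) ^ 2 * (4 * t *
          (Fintype.card V * (normRank X k * (1 - normRank X k))) / spectralGap p) := by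
        gcongr
        exact h.integral_sq_sum_comparison_le hp hG X k t
    _ = 4 * ((Fintype.card V : ℝ) ^ 3 * (normRank X k * (1 - normRank X k))) /
          (spectralGap p * t) := by field_simp

end IsEdgeSampling

/-! ### Accuracy of the weights -/

section Weights

variable [Fintype V]

theorem trimCount_le (V : Type*) [Fintype V] {α : ℝ} (hα : 0 ≤ α) :
    (trimCount V α : ℝ) ≤ α * Fintype.card V :=
  Nat.floor_le (by positivity)

theorem one_sub_two_mul_le_trim [Nonempty V] {α : ℝ} (hα : 0 ≤ α) :
    1 - 2 * α ≤ 1 - 2 * (trimCount V α : ℝ) / Fintype.card V := by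
  have hn : (0 : ℝ) < Fintype.card V := by exact_mod_cast Fintype.card_pos
  rw [mul_div_assoc]
  linarith [(div_le_iff₀ hn).2 (trimCount_le V hα)]

theorem abs_sub_add_half_pos (a b : ℤ) : 0 < |(a : ℝ) - (b + 1 / 2)| := by
  refine abs_pos.2 fun h => ?_
  have : ((2 * a : ℤ) : ℝ) = ((2 * b + 1 : ℤ) : ℝ) := by push_cast; linarith
  have : 2 * a = 2 * b + 1 := by exact_mod_cast this
  omega

theorem gap_pos (α : ℝ) (X : V → ℝ) (k : V) : 0 < gap α X k := by
  refine lt_min ?_ ?_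
  · exact_mod_cast abs_sub_add_half_pos (rank X k) (trimCount V α)
  · simpa only [rightEnd, Int.cast_sub, Int.cast_natCast] using
      abs_sub_add_half_pos (rank X k) (Fintype.card V - trimCount V α)

theorem weightFun_eq_of_abs_sub_lt {α : ℝ} {X : V → ℝ} {k : V} {r : ℝ}
    (h : |r - rank X k| < gap α X k) : weightFun V α r = weightFun V α (rank X k) := by
  obtain ⟨hl, hr⟩ := abs_lt.1 h
  have ha : gap α X k ≤ |(rank X k : ℝ) - leftEnd V α| := min_le_left _ _
  have hb : gap α X k ≤ |(rank X k : ℝ) - rightEnd V α| := min_le_right _ _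
  have hleft : leftEnd V α ≤ r ↔ leftEnd V α ≤ rank X k := by
    rcases abs_cases ((rank X k : ℝ) - leftEnd V α) with ⟨_, _⟩ | ⟨_, _⟩ <;>
      constructor <;> intro <;> linarith
  have hright : r ≤ rightEnd V α ↔ (rank X k : ℝ) ≤ rightEnd V α := by
    rcases abs_cases ((rank X k : ℝ) - rightEnd V α) with ⟨_, _⟩ | ⟨_, _⟩ <;>
      constructor <;> intro <;> linarith
  simp only [weightFun, hleft, hright]

variable [Nonempty V] {α : ℝ}

theorem weightFun_mem_Icc (hα : 0 ≤ α) (hα' : α < 1 / 2) (r : ℝ) :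
    weightFun V α r ∈ Set.Icc 0 (1 / (1 - 2 * α)) := by
  have hpos : 0 < 1 - 2 * α := by linarith
  have hle := one_sub_two_mul_le_trim (V := V) hα
  rw [weightFun]
  split_ifs
  · exact ⟨one_div_nonneg.2 (hpos.le.trans hle), one_div_le_one_div_of_le hpos hle⟩
  · exact ⟨le_rfl, one_div_nonneg.2 hpos.le⟩

theorem abs_weightFun_sub_le (hα : 0 ≤ α) (hα' : α < 1 / 2) (X : V → ℝ) (k : V) (r : ℝ) :
    |weightFun V α r - weightFun V α (rank X k)| ≤
      |r - rank X k| / (gap α X k * (1 - 2 * α)) := by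
  have hg := gap_pos α X k
  have hpos : 0 < 1 - 2 * α := by linarith
  rcases lt_or_ge |r - rank X k| (gap α X k) with h | h
  · rw [weightFun_eq_of_abs_sub_lt h, sub_self, abs_zero]
    positivity
  · have hw := weightFun_mem_Icc (V := V) hα hα'
    calc |weightFun V α r - weightFun V α (rank X k)| ≤ 1 / (1 - 2 * α) :=
          abs_sub_le_of_nonneg_of_le (hw _).1 (hw _).2 (hw _).1 (hw _).2
      _ = gap α X k / (gap α X k * (1 - 2 * α)) := by field_simp
      _ ≤ |r - rank X k| / (gap α X k * (1 - 2 * α)) := by gcongr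

end Weights

section TrimmedMean

variable [Fintype V]

theorem leftEnd_le_iff (α : ℝ) (r : ℕ) : leftEnd V α ≤ r ↔ trimCount V α + 1 ≤ r := by
  rw [leftEnd]
  refine ⟨fun h => Nat.lt_of_not_ge fun hr => ?_, fun h => ?_⟩
  · have : (r : ℝ) ≤ trimCount V α := by exact_mod_cast hr
    linarith
  · have : (trimCount V α : ℝ) + 1 ≤ r := by exact_mod_cast h
    linarith

theorem le_rightEnd_iff (α : ℝ) (r : ℕ) :
    r ≤ rightEnd V α ↔ r + trimCount V α ≤ Fintype.card V := by
  rw [rightEnd]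
  refine ⟨fun h => Nat.le_of_lt_succ (Nat.lt_of_not_ge fun hr => ?_), fun h => ?_⟩
  · have : (Fintype.card V : ℝ) + 1 ≤ r + trimCount V α := by exact_mod_cast hr
    linarith
  · have : (r : ℝ) + trimCount V α ≤ Fintype.card V := by exact_mod_cast h
    linarith

theorem trimmedMean_eq [Nonempty V] {α : ℝ} (hα : 0 ≤ α) (hα' : α < 1 / 2) (X : V → ℝ) :
    trimmedMean α X = (∑ k, weightFun V α (rank X k) * X k) / Fintype.card V := by
  have hn : (0 : ℝ) < Fintype.card V := by exact_mod_cast Fintype.card_pos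
  have hm : (0 : ℝ) < Fintype.card V - 2 * trimCount V α := by
    nlinarith [trimCount_le V hα]
  simp only [weightFun, leftEnd_le_iff, le_rightEnd_iff, ite_mul, zero_mul]
  rw [trimmedMean, ← Finset.sum_filter, ← Finset.mul_sum]
  field_simp

end TrimmedMean

section WeightError

variable [DecidableEq V] [Fintype V] {Ω : Type*} [MeasurableSpace Ω] {μ : Measure Ω}
  {p : Sym2 V → ℝ} {ξ : ℕ → Ω → Sym2 V} {G : SimpleGraph V}

/-- The error of the weights against the weights of the true ranks, scaled by the observations:
`(W(t) - w(r)) ⊙ X`. -/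
noncomputable def weightError (α : ℝ) (X : V → ℝ) (e : ℕ → Sym2 V) (t : ℕ) (k : V) : ℝ :=
  (weight α X e t k - weightFun V α (rank X k)) * X k

theorem dependsOn_weightError (α : ℝ) (X : V → ℝ) (t : ℕ) :
    DependsOn (fun e => weightError α X e t) (Set.Iic t) :=
  dependsOn_comp (fun W k => (W k - weightFun V α (rank X k)) * X k) (dependsOn_weight α X t)

theorem sq_weightError_le [Nonempty V] {α : ℝ} (hα : 0 ≤ α) (hα' : α < 1 / 2) (X : V → ℝ)
    (e : ℕ → Sym2 V) {t : ℕ} (ht : t ≠ 0) (k : V) :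
    weightError α X e t k ^ 2 ≤
      (X k / (gap α X k * (1 - 2 * α))) ^ 2 * (rankEst X e t k - rank X k) ^ 2 := by
  obtain ⟨t, rfl⟩ := Nat.exists_eq_add_one_of_ne_zero ht
  have h := abs_weightFun_sub_le hα hα' X k (rankEst X e (t + 1) k)
  calc weightError α X e (t + 1) k ^ 2
      = |weightFun V α (rankEst X e (t + 1) k) - weightFun V α (rank X k)| ^ 2 * X k ^ 2 := by
        rw [weightError, weight, mul_pow, sq_abs]
    _ ≤ (|rankEst X e (t + 1) k - rank X k| / (gap α X k * (1 - 2 * α))) ^ 2 * X k ^ 2 := by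
        gcongr
    _ = (X k / (gap α X k * (1 - 2 * α))) ^ 2 * (rankEst X e (t + 1) k - rank X k) ^ 2 := by
        rw [div_pow, div_pow, sq_abs]
        ring

theorem IsEdgeSampling.rms_weightError_le [Nontrivial V] [IsProbabilityMeasure μ]
    (h : IsEdgeSampling μ p ξ) (hp : IsEdgeDistribution G p) (hG : G.Preconnected) {α : ℝ}
    (hα : 0 ≤ α) (hα' : α < 1 / 2) (X : V → ℝ) {t : ℕ} (ht : t ≠ 0) :
    rms μ (fun ω => weightError α X (ξ · ω) t) ≤
      l2norm (fun k => coeffK α X k * X k) / √(spectralGap p * t) := by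
  have hc := hp.spectralGap_pos hG
  refine rms_le_of_integral_le (div_nonneg (l2norm_nonneg _) (Real.sqrt_nonneg _)) ?_
  have hint (k : V) : Integrable (fun ω => weightError α X (ξ · ω) t k ^ 2) μ :=
    h.integrable (dependsOn_comp (fun v => v k ^ 2) (dependsOn_weightError α X t))
  simp only [l2norm_sq, div_pow]
  rw [integral_finsetSum _ fun k _ => hint k, Real.sq_sqrt (by positivity), Finset.sum_div]
  refine Finset.sum_le_sum fun k _ => ?_
  have hrank : Integrable (fun ω => (rankEst X (ξ · ω) t k - rank X k) ^ 2) μ := by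
    obtain ⟨t, rfl⟩ := Nat.exists_eq_add_one_of_ne_zero ht
    exact h.integrable (dependsOn_comp
      (fun R => (Fintype.card V * R k + 1 - rank X k : ℝ) ^ 2) (dependsOn_normRankEst_succ X t))
  calc ∫ ω, weightError α X (ξ · ω) t k ^ 2 ∂μ
      ≤ (X k / (gap α X k * (1 - 2 * α))) ^ 2 *
          ∫ ω, (rankEst X (ξ · ω) t k - rank X k) ^ 2 ∂μ := by
        rw [← integral_const_mul]
        exact integral_mono (hint k) (hrank.const_mul _)
          fun ω => sq_weightError_le hα hα' X _ ht k
    _ ≤ (X k / (gap α X k * (1 - 2 * α))) ^ 2 *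
          (6 * rankSigma (Fintype.card V) (rank X k) ^ 2 / (spectralGap p * t)) := by
        gcongr
        exact (h.integral_sq_rankEst_sub_le hp hG X k ht).trans (by gcongr; norm_num)
    _ = (coeffK α X k * X k) ^ 2 / (spectralGap p * t) := by
        have h6 : √6 ^ 2 = (6 : ℝ) := Real.sq_sqrt (by norm_num)
        simp only [coeffK, div_pow, mul_pow, h6]
        ring

end WeightError

/-! ### A perturbed contraction -/

section Recursion

variable {z : ℕ → ℝ} {ρ A w : ℝ}

theorem one_div_sqrt_add_one_le {x : ℝ} (hx : 0 ≤ x) : 1 / √(x + 1) ≤ 2 * √(x + 1) - 2 * √x := by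
  rw [div_le_iff₀ (by positivity)]
  nlinarith [sq_nonneg (√(x + 1) - √x), Real.sq_sqrt hx, Real.sq_sqrt (show 0 ≤ x + 1 by linarith)]

theorem mul_sqrt_add_one_le {x : ℝ} (hρ : 0 ≤ ρ) (hρ' : ρ < 1) (hx : 0 ≤ x)
    (h : 1 ≤ x * (1 - ρ)) : ρ * (4 + (1 - ρ)) * √(x + 1) ≤ 4 * √x := by
  have hsqrt : √(x + 1) ≤ √x * (1 + (1 - ρ) / 2) := by
    refine Real.sqrt_le_iff.2 ⟨by have : 0 < 1 - ρ := sub_pos.2 hρ'; positivity, ?_⟩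
    rw [mul_pow, Real.sq_sqrt hx]
    nlinarith [mul_nonneg hx (sq_nonneg (1 - ρ))]
  calc ρ * (4 + (1 - ρ)) * √(x + 1)
      ≤ ρ * (4 + (1 - ρ)) * (√x * (1 + (1 - ρ) / 2)) := by
        have : 0 < 1 - ρ := sub_pos.2 hρ'
        gcongr
    _ = (ρ * (4 + (1 - ρ)) * (1 + (1 - ρ) / 2)) * √x := by ring
    _ ≤ 4 * √x := by
        gcongr
        nlinarith [mul_nonneg hρ (sub_nonneg.2 hρ'.le),
          mul_nonneg (mul_nonneg hρ (sub_nonneg.2 hρ'.le)) (sub_nonneg.2 hρ'.le)]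

theorem le_two_mul_sqrt_of_recursion (hρ : 0 ≤ ρ) (hρ' : ρ ≤ 1) (hA : 0 ≤ A) (h0 : z 0 ≤ 0)
    (hz : ∀ t : ℕ, z (t + 1) ≤ ρ * (z t + A / √(t + 1))) (t : ℕ) : z t ≤ 2 * A * √t := by
  induction t with
  | zero => simpa using h0
  | succ t ih =>
    calc z (t + 1) ≤ ρ * (z t + A / √(t + 1)) := hz t
      _ ≤ ρ * (2 * A * √t + A / √(t + 1)) := by gcongr
      _ ≤ 2 * A * √t + A * (1 / √(t + 1)) := by
          rw [mul_one_div]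
          exact mul_le_of_le_one_left (by positivity) hρ'
      _ ≤ 2 * A * √t + A * (2 * √(t + 1) - 2 * √t) := by
          gcongr
          exact one_div_sqrt_add_one_le t.cast_nonneg
      _ = 2 * A * √(t + 1 : ℕ) := by
          push_cast
          ring

theorem le_div_sqrt_of_recursion (hρ : 0 ≤ ρ) (hρ' : ρ < 1) (hA : 0 ≤ A) (h0 : z 0 ≤ 0)
    (hz : ∀ t : ℕ, z (t + 1) ≤ ρ * (z t + A / √(t + 1))) (t : ℕ) :
    z t ≤ 4 * A / ((1 - ρ) * √(t + 1)) := by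
  have hδ : 0 < 1 - ρ := sub_pos.2 hρ'
  induction t with
  | zero => exact h0.trans (by positivity)
  | succ t ih =>
    push_cast
    set x : ℝ := t + 1 with hx
    have hx0 : 0 < x := by positivity
    rcases le_or_gt 1 (x * (1 - ρ)) with hlarge | hsmall
    · calc z (t + 1) ≤ ρ * (z t + A / √x) := hz t
        _ ≤ ρ * (4 * A / ((1 - ρ) * √x) + A / √x) := by gcongr
        _ = A * (ρ * (4 + (1 - ρ)) * √(x + 1)) / ((1 - ρ) * √x * √(x + 1)) := by field_simp
        _ ≤ A * (4 * √x) / ((1 - ρ) * √x * √(x + 1)) := by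
            gcongr A * ?_ / ((1 - ρ) * √x * √(x + 1))
            exact mul_sqrt_add_one_le hρ hρ' hx0.le hlarge
        _ = 4 * A / ((1 - ρ) * √(x + 1)) := by field_simp
    · rw [le_div_iff₀ (by positivity)]
      calc z (t + 1) * ((1 - ρ) * √(x + 1))
          ≤ 2 * A * √x * ((1 - ρ) * √(x + 1)) := by
            gcongr
            simpa [hx] using le_two_mul_sqrt_of_recursion hρ hρ'.le hA h0 hz (t + 1)
        _ ≤ 2 * A * √(x + 1) * ((1 - ρ) * √(x + 1)) := by
            gcongr
            linarith
        _ = 2 * A * ((1 - ρ) * (x + 1)) := by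
            rw [mul_mul_mul_comm, Real.mul_self_sqrt (by positivity), mul_assoc]
        _ ≤ 2 * A * 2 := by
            gcongr
            linarith
        _ = 4 * A := by ring

theorem le_pow_mul_add_of_recursion (hρ : 0 ≤ ρ) (hρ' : ρ < 1) (hA : 0 ≤ A) (h0 : z 0 ≤ ρ * w)
    (hz : ∀ t : ℕ, z (t + 1) ≤ ρ * (z t + A / √(t + 1))) (t : ℕ) :
    z t ≤ ρ ^ (t + 1) * w + 4 * A / ((1 - ρ) * √(t + 1)) := by
  rw [← sub_le_iff_le_add']
  refine le_div_sqrt_of_recursion (z := fun t => z t - ρ ^ (t + 1) * w) hρ hρ' hA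
    (by simpa using h0) (fun s => ?_) t
  calc z (s + 1) - ρ ^ (s + 1 + 1) * w ≤ ρ * (z s + A / √(s + 1)) - ρ ^ (s + 1 + 1) * w := by
        gcongr
        exact hz s
    _ = ρ * (z s - ρ ^ (s + 1) * w + A / √(s + 1)) := by ring

end Recursion

/-! ### Consensus -/

section Center

variable [Fintype V]

/-- The deviation of a vector from its mean. -/
noncomputable def center (v : V → ℝ) : V → ℝ := v - fun _ => (∑ l, v l) / Fintype.card V

theorem center_add (v w : V → ℝ) : center (v + w) = center v + center w := by
  funext k
  simp only [center, Pi.add_apply, Pi.sub_apply, Finset.sum_add_distrib]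
  ring

theorem center_averagingMatrix_mulVec [DecidableEq V] (e : Sym2 V) (v : V → ℝ) :
    center (averagingMatrix e *ᵥ v) = averagingMatrix e *ᵥ center v := by
  rw [center, center, Matrix.mulVec_sub, averagingMatrix_mulVec_const, sum_averagingMatrix_mulVec]

variable [Nonempty V]

theorem sum_center (v : V → ℝ) : ∑ k, center v k = 0 := by
  simp [center, Finset.sum_sub_distrib, mul_div_cancel₀]

theorem l2norm_sq_eq_center_add_mean (v : V → ℝ) :
    l2norm v ^ 2 =
      l2norm (center v) ^ 2 + l2norm (fun _ : V => (∑ l, v l) / Fintype.card V) ^ 2 := by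
  set m : ℝ := (∑ l, v l) / Fintype.card V
  have h (k : V) : v k ^ 2 = center v k ^ 2 + m ^ 2 + 2 * m * center v k := by
    rw [center, Pi.sub_apply]
    ring
  simp only [l2norm_sq, h, Finset.sum_add_distrib, ← Finset.mul_sum, sum_center, mul_zero, add_zero]

theorem l2norm_center_le (v : V → ℝ) : l2norm (center v) ≤ l2norm v :=
  le_of_sq_le_sq (l2norm_sq_eq_center_add_mean v ▸ le_add_of_nonneg_right (sq_nonneg _))
    (l2norm_nonneg v)

theorem l2norm_mean_le (v : V → ℝ) :
    l2norm (fun _ : V => (∑ l, v l) / Fintype.card V) ≤ l2norm v :=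
  le_of_sq_le_sq (l2norm_sq_eq_center_add_mean v ▸ le_add_of_nonneg_left (sq_nonneg _))
    (l2norm_nonneg v)

end Center

section Estimate

variable [Fintype V] [DecidableEq V]

/-- The vector `(W(t + 1) - W(t)) ⊙ X` injected into the estimates at iteration `t + 1`. -/
noncomputable def increment (α : ℝ) (X : V → ℝ) (e : ℕ → Sym2 V) (t : ℕ) : V → ℝ :=
  (weight α X e (t + 1) - weight α X e t) * X

theorem dependsOn_increment (α : ℝ) (X : V → ℝ) (t : ℕ) :
    DependsOn (fun e => increment α X e t) (Set.Iic t) :=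
  dependsOn_comp (fun W : V → ℝ => W * X) (dependsOn_weight_sub α X t)

theorem increment_eq_weightError_sub (α : ℝ) (X : V → ℝ) (e : ℕ → Sym2 V) (t : ℕ) :
    increment α X e t = weightError α X e (t + 1) - weightError α X e t := by
  funext k
  simp only [increment, weightError, Pi.mul_apply, Pi.sub_apply]
  ring

theorem increment_zero (α : ℝ) (X : V → ℝ) (e : ℕ → Sym2 V) :
    increment α X e 0 = weightFun V α 1 • X := by
  funext k
  simp [increment, weight, rankEst, normRankEst, auxObs]

theorem sum_estimate (α : ℝ) (X : V → ℝ) (e : ℕ → Sym2 V) (t : ℕ) :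
    ∑ k, estimate α X e t k = ∑ k, weight α X e t k * X k := by
  induction t with
  | zero => simp [estimate, weight]
  | succ t ih =>
    rw [estimate, sum_averagingMatrix_mulVec]
    simp only [Pi.add_apply, Pi.mul_apply, Pi.sub_apply, Finset.sum_add_distrib, ih, sub_mul,
      Finset.sum_sub_distrib]
    ring

theorem center_estimate_succ (α : ℝ) (X : V → ℝ) (e : ℕ → Sym2 V) (t : ℕ) :
    center (estimate α X e (t + 1)) =
      averagingMatrix (e (t + 1)) *ᵥ (center (estimate α X e t) + center (increment α X e t)) := by
  rw [estimate, center_averagingMatrix_mulVec, center_add, increment]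

theorem estimate_sub_trimmedMean [Nonempty V] {α : ℝ} (hα : 0 ≤ α) (hα' : α < 1 / 2) (X : V → ℝ)
    (e : ℕ → Sym2 V) (t : ℕ) :
    (fun k => estimate α X e t k - trimmedMean α X) =
      center (estimate α X e t) + fun _ => (∑ l, weightError α X e t l) / Fintype.card V := by
  funext k
  simp only [Pi.add_apply, Pi.sub_apply, center, sum_estimate, trimmedMean_eq hα hα', weightError,
    sub_mul, Finset.sum_sub_distrib]
  ring

end Estimate

namespace IsEdgeSampling

variable [Fintype V] {Ω : Type*} [MeasurableSpace Ω] {μ : Measure Ω} {p : Sym2 V → ℝ}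
  {ξ : ℕ → Ω → Sym2 V}

theorem memLp_toLp [IsFiniteMeasure μ] (h : IsEdgeSampling μ p ξ) {t : ℕ}
    {F : (ℕ → Sym2 V) → V → ℝ} (hF : DependsOn F (Set.Iic t)) :
    MemLp (fun ω => toLp 2 (F (ξ · ω))) 2 μ :=
  h.memLp (dependsOn_comp (toLp 2) hF) 2

variable [DecidableEq V] [Nontrivial V] {G : SimpleGraph V}

theorem rms_averagingMatrix_mulVec_le [IsFiniteMeasure μ] (h : IsEdgeSampling μ p ξ)
    (hp : IsEdgeDistribution G p) (hG : G.Preconnected) {t : ℕ} {F : (ℕ → Sym2 V) → V → ℝ}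
    (hF : DependsOn F (Set.Iic t)) (hF0 : ∀ e, ∑ k, F e k = 0) :
    rms μ (fun ω => averagingMatrix (ξ (t + 1) ω) *ᵥ F (ξ · ω)) ≤
      (1 - cTilde p) * rms μ (fun ω => F (ξ · ω)) := by
  refine rms_le_of_integral_le
    (mul_nonneg (sub_nonneg.2 (cTilde_le_one p)) (rms_nonneg μ _)) ?_
  have hdep (e : Sym2 V) :
      DependsOn (fun x => l2norm (averagingMatrix e *ᵥ F x) ^ 2) (Set.Iic t) :=
    dependsOn_comp (fun v => l2norm (averagingMatrix e *ᵥ v) ^ 2) hF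
  have hint (e : Sym2 V) :
      Integrable (fun ω => p e * l2norm (averagingMatrix e *ᵥ F (ξ · ω)) ^ 2) μ :=
    (h.integrable (hdep e)).const_mul _
  rw [h.integral_next (F := fun x e => l2norm (averagingMatrix e *ᵥ F x) ^ 2) hdep, mul_pow,
    rms_sq, hp.one_sub_cTilde_sq, ← integral_const_mul]
  simp only [← integral_const_mul]
  rw [← integral_finsetSum _ fun e _ => hint e]
  refine integral_mono (integrable_finsetSum _ fun e _ => hint e)
    ((h.integrable (dependsOn_comp (l2norm · ^ 2) hF)).const_mul _) fun ω => ?_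
  simp only [← dotProduct_meanAveragingMatrix_mulVec]
  exact hp.dotProduct_meanAveragingMatrix_mulVec_le hG (hF0 _)

variable [IsProbabilityMeasure μ]

theorem rms_center_estimate_succ_le (h : IsEdgeSampling μ p ξ) (hp : IsEdgeDistribution G p)
    (hG : G.Preconnected) (α : ℝ) (X : V → ℝ) (t : ℕ) :
    rms μ (fun ω => center (estimate α X (ξ · ω) (t + 1))) ≤
      (1 - cTilde p) * (rms μ (fun ω => center (estimate α X (ξ · ω) t)) +
        rms μ (fun ω => increment α X (ξ · ω) t)) := by
  have hest := dependsOn_comp center (dependsOn_estimate α X t)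
  have hinc := dependsOn_comp center (dependsOn_increment α X t)
  have hcenter : rms μ (fun ω => center (increment α X (ξ · ω) t)) ≤
      rms μ (fun ω => increment α X (ξ · ω) t) :=
    rms_mono (h.memLp_toLp (dependsOn_increment α X t)) fun ω => l2norm_center_le _
  simp only [center_estimate_succ]
  refine (h.rms_averagingMatrix_mulVec_le hp hG (dependsOn_comp₂ (· + ·) hest hinc)
    fun e => ?_).trans ?_
  · simp only [Pi.add_apply, Finset.sum_add_distrib, sum_center, add_zero]
  · exact mul_le_mul_of_nonneg_left
      ((rms_add_le (h.memLp_toLp hest) (h.memLp_toLp hinc)).trans (by gcongr))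
      (sub_nonneg.2 (cTilde_le_one p))

variable {α : ℝ}

theorem rms_increment_le (h : IsEdgeSampling μ p ξ) (hp : IsEdgeDistribution G p)
    (hG : G.Preconnected) (hα : 0 ≤ α) (hα' : α < 1 / 2) (X : V → ℝ) {t : ℕ} (ht : t ≠ 0) :
    rms μ (fun ω => increment α X (ξ · ω) t) ≤
      2 * l2norm (fun k => coeffK α X k * X k) / √(spectralGap p * t) := by
  have hc := hp.spectralGap_pos hG
  simp only [increment_eq_weightError_sub]
  calc rms μ (fun ω => weightError α X (ξ · ω) (t + 1) - weightError α X (ξ · ω) t)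
      ≤ rms μ (fun ω => weightError α X (ξ · ω) (t + 1)) +
        rms μ (fun ω => weightError α X (ξ · ω) t) :=
      rms_sub_le (h.memLp_toLp (dependsOn_weightError α X (t + 1)))
        (h.memLp_toLp (dependsOn_weightError α X t))
    _ ≤ l2norm (fun k => coeffK α X k * X k) / √(spectralGap p * (t + 1 : ℕ)) +
        l2norm (fun k => coeffK α X k * X k) / √(spectralGap p * t) :=
      add_le_add (h.rms_weightError_le hp hG hα hα' X t.succ_ne_zero)
        (h.rms_weightError_le hp hG hα hα' X ht)
    _ ≤ l2norm (fun k => coeffK α X k * X k) / √(spectralGap p * t) +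
        l2norm (fun k => coeffK α X k * X k) / √(spectralGap p * t) := by
      have := l2norm_nonneg fun k => coeffK α X k * X k
      gcongr
      exact t.le_succ
    _ = 2 * l2norm (fun k => coeffK α X k * X k) / √(spectralGap p * t) := by ring

theorem rms_center_estimate_le (h : IsEdgeSampling μ p ξ) (hp : IsEdgeDistribution G p)
    (hG : G.Preconnected) (hα : 0 ≤ α) (hα' : α < 1 / 2) (X : V → ℝ) {t : ℕ} (ht : t ≠ 0) :
    rms μ (fun ω => center (estimate α X (ξ · ω) t)) ≤
      (1 - cTilde p) ^ t * (weightFun V α 1 * l2norm X) +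
        8 * (l2norm (fun k => coeffK α X k * X k) / (cTilde p * √(spectralGap p * t))) := by
  have hc := hp.spectralGap_pos hG
  have hct := hp.cTilde_pos hG
  have hB := l2norm_nonneg fun k => coeffK α X k * X k
  obtain ⟨t, rfl⟩ := Nat.exists_eq_add_one_of_ne_zero ht
  refine (le_pow_mul_add_of_recursion
    (z := fun t => rms μ (fun ω => center (estimate α X (ξ · ω) (t + 1))))
    (A := 2 * l2norm (fun k => coeffK α X k * X k) / √(spectralGap p))
    (w := weightFun V α 1 * l2norm X)
    (sub_nonneg.2 (cTilde_le_one p)) (by linarith) (by positivity) ?_ (fun s => ?_) t).trans_eq ?_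
  · have hzero : rms μ (fun ω => center (estimate α X (ξ · ω) 0)) = 0 := by
      simp [estimate, center, rms, l2norm_sq]
    have hfirst : rms μ (fun ω => increment α X (ξ · ω) 0) = weightFun V α 1 * l2norm X := by
      have hw : 0 ≤ weightFun V α 1 := (weightFun_mem_Icc hα hα' 1).1
      simp [increment_zero, rms, l2norm_smul, abs_of_nonneg hw,
        Real.sqrt_sq (mul_nonneg hw (l2norm_nonneg X))]
    simpa only [hzero, hfirst, zero_add] using h.rms_center_estimate_succ_le hp hG α X 0
  · refine (h.rms_center_estimate_succ_le hp hG α X (s + 1)).trans ?_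
    have := h.rms_increment_le hp hG hα hα' X s.succ_ne_zero
    rw [Real.sqrt_mul hc.le, ← div_div, Nat.cast_succ] at this
    gcongr
    exact sub_nonneg.2 (cTilde_le_one p)
  · rw [sub_sub_cancel, Real.sqrt_mul hc.le, Nat.cast_succ]
    field_simp
    ring

theorem integral_l2norm_estimate_sub_le (h : IsEdgeSampling μ p ξ) (hp : IsEdgeDistribution G p)
    (hG : G.Preconnected) (hα : 0 ≤ α) (hα' : α < 1 / 2) (X : V → ℝ) {t : ℕ} (ht : t ≠ 0) :
    ∫ ω, l2norm (fun k => estimate α X (ξ · ω) t k - trimmedMean α X) ∂μ ≤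
      (1 - cTilde p) ^ t * (weightFun V α 1 * l2norm X) +
        9 * (l2norm (fun k => coeffK α X k * X k) / (cTilde p * √(spectralGap p * t))) := by
  have hc := hp.spectralGap_pos hG
  have hct := hp.cTilde_pos hG
  have hB := l2norm_nonneg fun k => coeffK α X k * X k
  have hest := dependsOn_comp center (dependsOn_estimate α X t)
  have hmean := dependsOn_comp (fun v (_ : V) => (∑ l, v l) / (Fintype.card V : ℝ))
    (dependsOn_weightError α X t)
  have herr : rms μ (fun ω (_ : V) => (∑ l, weightError α X (ξ · ω) t l) / Fintype.card V) ≤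
      l2norm (fun k => coeffK α X k * X k) / (cTilde p * √(spectralGap p * t)) :=
    calc rms μ (fun ω (_ : V) => (∑ l, weightError α X (ξ · ω) t l) / Fintype.card V)
        ≤ rms μ (fun ω => weightError α X (ξ · ω) t) :=
          rms_mono (h.memLp_toLp (dependsOn_weightError α X t)) fun ω => l2norm_mean_le _
      _ ≤ l2norm (fun k => coeffK α X k * X k) / √(spectralGap p * t) :=
          h.rms_weightError_le hp hG hα hα' X ht
      _ ≤ l2norm (fun k => coeffK α X k * X k) / (cTilde p * √(spectralGap p * t)) := by
          gcongr
          exact mul_le_of_le_one_left (Real.sqrt_nonneg _) (cTilde_le_one p)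
  simp only [estimate_sub_trimmedMean hα hα']
  refine (integral_l2norm_le_rms (h.memLp_toLp (dependsOn_comp₂ (· + ·) hest hmean))).trans
    ((rms_add_le (h.memLp_toLp hest) (h.memLp_toLp hmean)).trans ?_)
  linarith [h.rms_center_estimate_le hp hG hα hα' X ht]

end IsEdgeSampling

/-! ### The first injection -/

section FirstInjection

variable [Fintype V] {α : ℝ} {X : V → ℝ}

theorem weightFun_one_of_trimCount_pos (hm : 0 < trimCount V α) : weightFun V α 1 = 0 := by
  refine if_neg fun h => ?_
  have := (leftEnd_le_iff α 1).1 (by exact_mod_cast h.1)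
  omega

theorem weightFun_one_le_of_trimCount_eq_zero (hm : trimCount V α = 0) : weightFun V α 1 ≤ 1 := by
  rw [weightFun]
  split_ifs <;> simp [hm]

theorem coeffK_eq_smul_of_trimCount_eq_zero (hm : trimCount V α = 0) (X : V → ℝ) :
    coeffK α X = (1 / (1 - 2 * α)) • coeffK 0 X := by
  have h0 : trimCount V 0 = 0 := by simp [trimCount]
  funext k
  simp only [Pi.smul_apply, smul_eq_mul, coeffK, gap, leftEnd, rightEnd, hm, h0, mul_zero,
    sub_zero, mul_one, one_div_mul_eq_div, div_div]

theorem l2norm_coeffK_zero_le (hα : 0 ≤ α) (hα' : α < 1 / 2) (hm : trimCount V α = 0)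
    (X : V → ℝ) :
    l2norm (fun k => coeffK 0 X k * X k) ≤ l2norm (fun k => coeffK α X k * X k) := by
  have hpos : 0 < 1 - 2 * α := by linarith
  have h : (fun k => coeffK α X k * X k) =
      (1 / (1 - 2 * α)) • fun k => coeffK 0 X k * X k := by
    simp only [coeffK_eq_smul_of_trimCount_eq_zero hm]
    exact smul_mul_assoc _ (coeffK 0 X) X
  rw [h, l2norm_smul]
  refine le_mul_of_one_le_left (l2norm_nonneg _) ?_
  rw [abs_of_pos (by positivity), le_div_iff₀ hpos]
  linarith

theorem coeffK_pos (hα' : α < 1 / 2) {k l : V} (h : X l < X k) : 0 < coeffK α X k := by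
  have hpos : 0 < 1 - 2 * α := by linarith
  have hn : (0 : ℝ) < Fintype.card V := by exact_mod_cast Fintype.card_pos_iff.2 ⟨k⟩
  have hscore : 0 < score (((rank X k : ℝ) - 1) / Fintype.card V) :=
    Real.sqrt_pos.2 (mul_pos (normRank_pos h) (sub_pos.2 (normRank_lt_one X k)))
  have hg := gap_pos α X k
  rw [coeffK, rankSigma]
  positivity

theorem l2norm_coeffK_pos (hα' : α < 1 / 2) (hV : 3 ≤ Fintype.card V)
    (hX : Function.Injective X) : 0 < l2norm (fun k => coeffK α X k * X k) := by
  have : Nonempty V := Fintype.card_pos_iff.1 (by omega)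
  obtain ⟨l, hl⟩ := Finite.exists_min X
  obtain ⟨k, hk, hXk⟩ : ∃ k, k ≠ l ∧ X k ≠ 0 := by
    classical
    have hcard : 1 < (Finset.univ.erase l).card := by
      rw [Finset.card_erase_of_mem (Finset.mem_univ _), Finset.card_univ]
      omega
    obtain ⟨a, ha, b, hb, hab⟩ := Finset.one_lt_card.1 hcard
    by_contra! hzero
    exact hab (hX ((hzero a (Finset.ne_of_mem_erase ha)).trans
      (hzero b (Finset.ne_of_mem_erase hb)).symm))
  have hlt : X l < X k := lt_of_le_of_ne (hl k) fun h => hk (hX h.symm)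
  calc 0 < |coeffK α X k * X k| := abs_pos.2 (mul_ne_zero (coeffK_pos hα' hlt).ne' hXk)
    _ ≤ l2norm (fun k => coeffK α X k * X k) :=
      abs_apply_le_l2norm (fun k => coeffK α X k * X k) k

theorem exists_forall_pow_mul_le {x : ℝ} (hx0 : 0 < x) (hx1 : x ≤ 1) (M : ℝ) {κ : ℝ}
    (hκ : 0 < κ) : ∃ T : ℝ, ∀ t : ℕ, T < t → (1 - x) ^ t * M * (2 * t) ≤ κ := by
  have h := (tendsto_pow_const_mul_const_pow_of_abs_lt_one 1
    (abs_lt.2 ⟨by linarith, by linarith⟩ : |1 - x| < 1)).mul_const (2 * M)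
  rw [zero_mul] at h
  obtain ⟨N, hN⟩ := Filter.eventually_atTop.1 (h.eventually (ge_mem_nhds hκ))
  refine ⟨N, fun t ht => ?_⟩
  calc (1 - x) ^ t * M * (2 * t) = (t : ℝ) ^ 1 * (1 - x) ^ t * (2 * M) := by ring
    _ ≤ κ := hN t (by exact_mod_cast ht.le)

/-- On two vertices the right-hand side may vanish, but then `c̃ = 1` and the first injection is
forgotten at once. -/
theorem exists_threshold (hX : Function.Injective X) :
    ∃ T : ℝ → ℝ, ∀ x, 0 < x → x ≤ 1 → (Fintype.card V ≤ 2 → x = 1) →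
      ∀ t : ℕ, t ≠ 0 → T x < t →
        (1 - x) ^ t * l2norm X * (2 * t) ≤ l2norm (fun k => coeffK 0 X k * X k) := by
  rcases le_or_gt (Fintype.card V) 2 with hV | hV
  · refine ⟨fun _ => 0, fun x _ _ hx t ht _ => ?_⟩
    rw [hx hV, sub_self, zero_pow ht, zero_mul, zero_mul]
    exact l2norm_nonneg _
  · have h : ∀ x : ℝ, 0 < x → x ≤ 1 → ∃ T : ℝ, ∀ t : ℕ, T < t →
        (1 - x) ^ t * l2norm X * (2 * t) ≤ l2norm (fun k => coeffK 0 X k * X k) :=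
      fun x hx0 hx1 => exists_forall_pow_mul_le hx0 hx1 _ (l2norm_coeffK_pos (by norm_num) hV hX)
    choose! T hT using h
    exact ⟨T, fun x hx0 hx1 _ t _ => hT x hx0 hx1 t⟩

end FirstInjection

section Bound

variable [Fintype V] [DecidableEq V] [Nontrivial V] {G : SimpleGraph V} {p : Sym2 V → ℝ} {α : ℝ}

theorem IsEdgeDistribution.first_injection_le (hp : IsEdgeDistribution G p) (hG : G.Preconnected)
    (hα : 0 ≤ α) (hα' : α < 1 / 2) (hm : trimCount V α = 0) {X : V → ℝ} {t : ℕ} (ht : t ≠ 0)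
    (h : (1 - cTilde p) ^ t * l2norm X * (2 * t) ≤ l2norm (fun k => coeffK 0 X k * X k)) :
    (1 - cTilde p) ^ t * (weightFun V α 1 * l2norm X) ≤
      l2norm (fun k => coeffK α X k * X k) / (cTilde p * √(spectralGap p * t)) := by
  have hc := hp.spectralGap_pos hG
  have hct := hp.cTilde_pos hG
  have hrate : cTilde p * √(spectralGap p * t) ≤ 2 * t := by
    refine (mul_le_of_le_one_left (Real.sqrt_nonneg _) (cTilde_le_one p)).trans
      (Real.sqrt_le_iff.2 ⟨by positivity, ?_⟩)
    have : (1 : ℝ) ≤ t := by exact_mod_cast Nat.one_le_iff_ne_zero.2 ht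
    nlinarith [hp.spectralGap_le_two]
  have hpow : 0 ≤ (1 - cTilde p) ^ t := pow_nonneg (sub_nonneg.2 (cTilde_le_one p)) _
  have hXnonneg := l2norm_nonneg X
  rw [le_div_iff₀ (by positivity)]
  calc (1 - cTilde p) ^ t * (weightFun V α 1 * l2norm X) * (cTilde p * √(spectralGap p * t))
      ≤ (1 - cTilde p) ^ t * (1 * l2norm X) * (2 * t) := by
        gcongr
        exact weightFun_one_le_of_trimCount_eq_zero hm
    _ ≤ l2norm (fun k => coeffK 0 X k * X k) := by rwa [one_mul]
    _ ≤ l2norm (fun k => coeffK α X k * X k) := l2norm_coeffK_zero_le hα hα' hm X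

theorem IsEdgeSampling.integral_l2norm_estimate_sub_le_of_first_injection_le {Ω : Type*}
    [MeasurableSpace Ω] {μ : Measure Ω} [IsProbabilityMeasure μ] {ξ : ℕ → Ω → Sym2 V}
    (h : IsEdgeSampling μ p ξ) (hp : IsEdgeDistribution G p) (hG : G.Preconnected)
    (hα : 0 ≤ α) (hα' : α < 1 / 2) {X : V → ℝ} {t : ℕ} (ht : t ≠ 0)
    (hfirst : (1 - cTilde p) ^ t * (weightFun V α 1 * l2norm X) ≤
      l2norm (fun k => coeffK α X k * X k) / (cTilde p * √(spectralGap p * t))) :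
    ∫ ω, l2norm (fun k => estimate α X (ξ · ω) t k - trimmedMean α X) ∂μ ≤
      10 * (1 / (cTilde p * √(spectralGap p * t))) * l2norm (fun k => coeffK α X k * X k) := by
  rw [mul_assoc, one_div_mul_eq_div]
  linarith [h.integral_l2norm_estimate_sub_le hp hG hα hα' X ht]

end Bound

end GoTrim

theorem theorem3_general :
    ∃ C : ℝ, 0 < C ∧
      ∀ (V : Type*) [Fintype V] [DecidableEq V] [Nontrivial V]
        (X : V → ℝ), Function.Injective X →
      ∃ T₁ : ℝ → ℝ,
      ∀ (G : SimpleGraph V), G.Connected →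
      ∀ (p : Sym2 V → ℝ), GoTrim.IsEdgeDistribution G p →
      ∀ α : ℝ, 0 ≤ α → α < 1 / 2 →
      ∃ Tstar : ℝ, 0 < Tstar ∧
        Tstar ≤ T₁ (GoTrim.cTilde p) ∧
        (1 ≤ GoTrim.trimCount V α → Tstar ≤ 1) ∧
        ∀ (Ω : Type*) [MeasurableSpace Ω] (μ : MeasureTheory.Measure Ω)
          [MeasureTheory.IsProbabilityMeasure μ] (ξ : ℕ → Ω → Sym2 V),
          GoTrim.IsEdgeSampling μ p ξ →
          ∀ t : ℕ, Tstar < (t : ℝ) →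
            ∫ ω, GoTrim.l2norm (fun k =>
                GoTrim.estimate α X (fun s => ξ s ω) t k - GoTrim.trimmedMean α X) ∂μ
              ≤ C * (1 / (GoTrim.cTilde p * √(GoTrim.spectralGap p * (t : ℝ)))) *
                  GoTrim.l2norm (fun k => GoTrim.coeffK α X k * X k) := by
  refine ⟨10, by norm_num, fun V _ _ _ X hX => ?_⟩
  obtain ⟨T, hT⟩ := GoTrim.exists_threshold hX
  refine ⟨fun x => max 1 (T x), fun G hG p hp α hα hα' => ?_⟩
  have hc := hp.spectralGap_pos hG.preconnected
  have hct := hp.cTilde_pos hG.preconnected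
  have hne {t : ℕ} (ht : (1 : ℝ) < t) : t ≠ 0 := by
    rintro rfl
    norm_num at ht
  rcases (GoTrim.trimCount V α).eq_zero_or_pos with hm | hm
  · refine ⟨max 1 (T (GoTrim.cTilde p)), by positivity, le_rfl, by omega,
      fun Ω _ μ _ ξ hξ t ht => ?_⟩
    obtain ⟨ht1, htT⟩ := max_lt_iff.1 ht
    refine hξ.integral_l2norm_estimate_sub_le_of_first_injection_le hp hG.preconnected hα hα'
      (hne ht1) (hp.first_injection_le hG.preconnected hα hα' hm (hne ht1)
        (hT _ hct (GoTrim.cTilde_le_one p) (fun hV => ?_) t (hne ht1) htT))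
    exact hp.cTilde_eq_one_of_card_eq_two hG.preconnected (hV.antisymm Fintype.one_lt_card)
  · refine ⟨1, one_pos, le_max_left _ _, fun _ => le_rfl, fun Ω _ μ _ ξ hξ t ht => ?_⟩
    refine hξ.integral_l2norm_estimate_sub_le_of_first_injection_le hp hG.preconnected hα hα'
      (hne ht) ?_
    rw [GoTrim.weightFun_one_of_trimCount_pos hm, zero_mul, mul_zero]
    have := GoTrim.l2norm_nonneg fun k => GoTrim.coeffK α X k * X k
    positivity

theorem theorem3 :
    ∃ C : ℝ, 0 < C ∧ ∃ T₀ : ℝ → ℝ,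
      ∀ (V : Type*) [Fintype V] [DecidableEq V] [Nontrivial V]
        (X : V → ℝ), Function.Injective X →
      ∃ T₁ : ℝ → ℝ,
      ∀ (G : SimpleGraph V), G.Connected → ¬ G.IsBipartite →
      ∀ (p : Sym2 V → ℝ), GoTrim.IsEdgeDistribution G p →
      ∀ α : ℝ, 0 < α → α < 1 / 2 →
      ∃ Tstar : ℝ, 0 < Tstar ∧
        Tstar ≤ T₁ (GoTrim.cTilde p) ∧
        (1 ≤ GoTrim.trimCount V α → Tstar ≤ T₀ (GoTrim.cTilde p)) ∧
        ∀ (Ω : Type*) [MeasurableSpace Ω] (μ : MeasureTheory.Measure Ω)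
          [MeasureTheory.IsProbabilityMeasure μ] (ξ : ℕ → Ω → Sym2 V),
          GoTrim.IsEdgeSampling μ p ξ →
          ∀ t : ℕ, Tstar < (t : ℝ) →
            ∫ ω, GoTrim.l2norm (fun k =>
                GoTrim.estimate α X (fun s => ξ s ω) t k - GoTrim.trimmedMean α X) ∂μ
              ≤ C * (1 / (GoTrim.cTilde p * √(GoTrim.spectralGap p * (t : ℝ)))) *
                  GoTrim.l2norm (fun k => GoTrim.coeffK α X k * X k) := by
  obtain ⟨C, hC, h⟩ := theorem3_general
  exact ⟨C, hC, fun _ => 1, fun V _ _ _ X hX =>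
    (h V X hX).imp fun _ hT G hG _ p hp α hα => hT G hG p hp α hα.le⟩
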